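/- Conventions. Let $U\subset\mathbb C^{n+1}$ be open, $\varrho\colon U\to\mathbb R$ smooth, and $M=\{z\in U:\varrho(z)=0\}$ with $d\varrho\neq 0$ on $M$. Write $\varrho_j=\partial\varrho/\partial z_j$, $\varrho_{\bar k}=\partial\varrho/\partial\bar z_k$, and similarly for higher derivatives, and let $T^{1,0}M=\{Z=\sum_j Z_j\,\partial/\partial z_j : \sum_j\varrho_jZ_j=0\}$ along $M$. Let $\theta=\iota^*(i\bar\partial\varrho)$, where $\iota\colon M\to\mathbb C^{n+1}$ is the inclusion, with Levi metric $\langle Z,\overline W\rangle=-i\,d\theta(Z,\overline W)=\sum_{j,k}\varrho_{j\bar k}Z_j\overline{W_k}$ and $|Z|^2=\langle Z,\overline Z\rangle$. Let $\nabla$ be the Tanaka–Webster connection of $(M,\theta)$, $R(X,Y)=\nabla_X\nabla_Y-\nabla_Y\nabla_X-\nabla_{[X,Y]}$ its curvature, $R_{\alpha\bar\beta\gamma\bar\sigma}=\langle R(Z_\gamma,Z_{\bar\sigma})Z_\alpha,Z_{\bar\beta}\rangle$ in a local frame $(Z_\alpha)$ of $T^{1,0}M$ with Levi matrix $h_{\alpha\bar\beta}=\langle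 Z_\alpha,Z_{\bar\beta}\rangle$ and inverse transpose $h^{\alpha\bar\beta}$. The holomorphic sectional curvature of $0\ne Z=\zeta^\alpha Z_\alpha$ is $K(Z)=\tfrac12R_{\alpha\bar\beta\gamma\bar\sigma}\zeta^\alpha\overline{\zeta^\beta}\zeta^\gamma\overline{\zeta^\sigma}/|Z|^4$, and the scalar curvature is $R=h^{\alpha\bar\beta}h^{\gamma\bar\sigma}R_{\alpha\bar\beta\gamma\bar\sigma}$. Corollary 1.3. Suppose that $a=(a_{j\bar k})$ is a constant positive definite Hermitian matrix such that, for all $j,k$ and all $p\in M$, $\varrho_{j\bar k}(z)=a_{j\bar k}+o(\varrho(z))$ as $z\to p$. Let $|\partial\varrho|^2=\sum_{j,k}a^{j\bar k}\varrho_j\varrho_{\bar k}$, where $(a^{j\bar k})$ is the inverse transpose of $(a_{j\bar k})$. If $M$ is $\mathbb C$-convex, in the sense that $$\operatorname{Re}\sum_{j,k}\varrho_{jk}(p)\eta_j\eta_k+\sum_{j,k}\varrho_{j\bar k}(p)\eta_j\overline{\eta_k}\ \ge\ 0$$ for all $p\in M$ and all $\eta\in\mathbb C^{n+1}$ with $\sum_j\varrho_j(p)\eta_j=0$,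 then at every point of $M$ and for every nonzero $Z\in T^{1,0}M$, $$K(Z)\ \ge\ \tfrac12\,|\partial\varrho|^{-2}.$$ In particular, let $n\ge1$, let $a_j,b_j>0$ $(1\le j\le n+1)$, and consider the real ellipsoid $E=\{\varrho=0\}\subset\mathbb C^{n+1}$ with $\varrho(z)=\sum_j(a_jx_j^2+b_jy_j^2)-1$, $z_j=x_j+iy_j$, and $\theta=\iota^*(i\bar\partial\varrho)$. Then the Tanaka–Webster scalar curvature of $(E,\theta)$ is positive everywhere. -/

import Mathlib

open Topology Asymptotics
open scoped ContDiff ComplexOrder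

noncomputable section

namespace Pseudohermitian

/-! ### Complex vector fields on `ℂⁿ⁺¹` -/

/-- The space `ℂⁿ⁺¹`. -/
abbrev Cn (n : ℕ) : Type := Fin (n + 1) → ℂ

/-- The Wirtinger derivative `∂f/∂z_j` at `p`. -/
def dz {n : ℕ} (f : Cn n → ℂ) (j : Fin (n + 1)) (p : Cn n) : ℂ :=
  (fderiv ℝ f p (Pi.single j 1) - Complex.I * fderiv ℝ f p (Pi.single j Complex.I)) / 2

/-- The Wirtinger derivative `∂f/∂z̄_j` at `p`. -/
def dzbar {n : ℕ} (f : Cn n → ℂ) (j : Fin (n + 1)) (p : Cn n) : ℂ :=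
  (fderiv ℝ f p (Pi.single j 1) + Complex.I * fderiv ℝ f p (Pi.single j Complex.I)) / 2

/-- A complex vector field: the pair `(u, v)` of coefficient functions stands for
`∑ u_j ∂/∂z_j + ∑ v_j ∂/∂z̄_j`. -/
abbrev CField (n : ℕ) : Type := Cn n → Cn n × Cn n

/-- The `(1,0)`-field `∑ Z_j ∂/∂z_j`. -/
def hol {n : ℕ} (Z : Cn n → Cn n) : CField n := fun p => (Z p, 0)

/-- The `(0,1)`-field `∑ W_j ∂/∂z̄_j`. -/
def antihol {n : ℕ} (W : Cn n → Cn n) : CField n := fun p => (0, W p)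

/-- The conjugate `∑ conj(Z_j) ∂/∂z̄_j` of the `(1,0)`-field `∑ Z_j ∂/∂z_j`. -/
def conjField {n : ℕ} (Z : Cn n → Cn n) : CField n := antihol fun p => star (Z p)

/-- The derivative `X f` of a function along a complex vector field. -/
def lieD {n : ℕ} (X : CField n) (f : Cn n → ℂ) (p : Cn n) : ℂ :=
  ∑ j, ((X p).1 j * dz f j p + (X p).2 j * dzbar f j p)

/-- The Lie bracket `[X, Y]` of complex vector fields. -/
def bracket {n : ℕ} (X Y : CField n) : CField n := fun p =>
  (fun k => lieD X (fun q => (Y q).1 k) p - lieD Y (fun q => (X q).1 k) p,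
   fun k => lieD X (fun q => (Y q).2 k) p - lieD Y (fun q => (X q).2 k) p)

/-! ### The pseudohermitian structure `θ = ι^*(i ∂̄ρ)` of a level set of `ρ` -/

/-- `ρ_j = ∂ρ/∂z_j`. -/
def rhoD {n : ℕ} (ρ : Cn n → ℝ) (p : Cn n) : Cn n := fun j => dz (fun z => (ρ z : ℂ)) j p

/-- `ρ_k̄ = ∂ρ/∂z̄_k`. -/
def rhoDbar {n : ℕ} (ρ : Cn n → ℝ) (p : Cn n) : Cn n := fun k => dzbar (fun z => (ρ z : ℂ)) k p

/-- `ρ_{jk} = ∂²ρ/∂z_j∂z_k`. -/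
def rhoDD {n : ℕ} (ρ : Cn n → ℝ) (p : Cn n) : Matrix (Fin (n + 1)) (Fin (n + 1)) ℂ :=
  fun j k => dz (fun q => rhoD ρ q k) j p

/-- The complex Hessian `ρ_{jk̄} = ∂²ρ/∂z_j∂z̄_k`. -/
def leviMat {n : ℕ} (ρ : Cn n → ℝ) (p : Cn n) : Matrix (Fin (n + 1)) (Fin (n + 1)) ℂ :=
  fun j k => dz (fun q => rhoDbar ρ q k) j p

/-- The form `θ = i ∂̄ρ` evaluated on a complex tangent vector. -/
def theta {n : ℕ} (ρ : Cn n → ℝ) (p : Cn n) (X : Cn n × Cn n) : ℂ :=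
  Complex.I * ∑ k, rhoDbar ρ p k * X.2 k

/-- `dθ = i ∂∂̄ρ = i ∑ ρ_{jk̄} dz_j ∧ dz̄_k` evaluated on two complex tangent vectors. -/
def dtheta {n : ℕ} (ρ : Cn n → ℝ) (p : Cn n) (X Y : Cn n × Cn n) : ℂ :=
  Complex.I * ∑ j, ∑ k, leviMat ρ p j k * (X.1 j * Y.2 k - Y.1 j * X.2 k)

/-- The Levi metric `⟨Z, W̄⟩ = -i dθ(Z, W̄)` on `(1,0)`-vectors. -/
def levi {n : ℕ} (ρ : Cn n → ℝ) (p : Cn n) (Z W : Cn n) : ℂ :=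
  -Complex.I * dtheta ρ p (Z, 0) (0, star W)

/-- The vector `φ^♯` with `∑_j ρ_{jk̄} (φ^♯)_j = φ_k`, where `ρ_{jk̄}` is invertible. -/
def sharp {n : ℕ} (ρ : Cn n → ℝ) (p : Cn n) (φ : Cn n) : Cn n :=
  Matrix.vecMul φ (leviMat ρ p)⁻¹

/-- The `(1,0)`-vector `ξ = (∂̄ρ)^♯`; it spans the orthogonal complement of `T^{1,0}`, since
`∑ ρ_{jk̄} ξ_j W̄_k = ∑ ρ_k̄ W̄_k`. -/
def normalVec {n : ℕ} (ρ : Cn n → ℝ) (p : Cn n) : Cn n := sharp ρ p (rhoDbar ρ p)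

/-- The `(1,0)`-part `i ξ / ∂ρ(ξ)` of the Reeb field. -/
def reeb10 {n : ℕ} (ρ : Cn n → ℝ) (p : Cn n) : Cn n :=
  (Complex.I / (rhoD ρ p ⬝ᵥ normalVec ρ p)) • normalVec ρ p

/-- The Reeb field: the real field tangent to the level set with `θ(T) = 1` and `T ⌟ dθ = 0` on
tangent vectors. -/
def reeb {n : ℕ} (ρ : Cn n → ℝ) : CField n := fun p => (reeb10 ρ p, star (reeb10 ρ p))

/-- The component of a tangent field in `T^{1,0}`, in the splitting
`ℂT = T^{1,0} ⊕ T^{0,1} ⊕ ℂ T`. -/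
def proj10 {n : ℕ} (ρ : Cn n → ℝ) (X : CField n) : Cn n → Cn n := fun p =>
  (X p).1 - theta ρ p (X p) • (reeb ρ p).1

/-- The component of a tangent field in `T^{0,1}`, in the same splitting. -/
def proj01 {n : ℕ} (ρ : Cn n → ℝ) (X : CField n) : Cn n → Cn n := fun p =>
  (X p).2 - theta ρ p (X p) • (reeb ρ p).2

/-! ### The Tanaka–Webster connection on `T^{1,0}` and its curvature -/

/-- `∇_X Y` for `(1,0)`-fields `X`, `Y`. It is the section of `T^{1,0}` determined by the
compatibility with the Levi metric,
`⟨∇_X Y, W̄⟩ = X⟨Y, W̄⟩ - ⟨Y, ∇_X W̄⟩` with `∇_X W̄` the `(0,1)`-component of `[X, W̄]`.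
The right-hand side equals `∑_k φ_k W̄_k` with `φ_k = X (∑_j ρ_{jk̄} Y_j)`,
as `⟨Y, ·⟩` kills `T` and the `k`-th antiholomorphic coefficient of `[X, W̄]` is `X W̄_k`;
so `∇_X Y` is the orthogonal projection of `φ^♯` to `T^{1,0}`. -/
def nabla10 {n : ℕ} (ρ : Cn n → ℝ) (X Y : Cn n → Cn n) : Cn n → Cn n := fun p =>
  let V : Cn n := sharp ρ p fun k => lieD (hol X) (fun q => ∑ j, leviMat ρ q j k * Y q j) p
  V - ((rhoD ρ p ⬝ᵥ V) / (rhoD ρ p ⬝ᵥ normalVec ρ p)) • normalVec ρ p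

/-- The Tanaka–Webster covariant derivative `∇_X Y` of a section `Y` of `T^{1,0}` along a complex
tangent field `X = X' + X'' + θ(X) T`, `X'` of type `(1,0)` and `X''` of type `(0,1)`:
`∇_{X'} Y` is fixed by metric compatibility, `∇_{X''} Y` is the `(1,0)`-component of `[X'', Y]`,
and `∇_T Y` is the `(1,0)`-component of `[T, Y]`. These are the structure equations
`dθ^β = θ^α ∧ ω_α^β + A^β_ᾱ θ ∧ θ^ᾱ`, `dh_{αβ̄} = ω_α^γ h_{γβ̄} + h_{αγ̄} ω_β̄^γ̄` solved
for the connection forms. Along the hypersurface only derivatives tangent to it occur. -/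
def nabla {n : ℕ} (ρ : Cn n → ℝ) (X : CField n) (Y : Cn n → Cn n) : Cn n → Cn n := fun p =>
  nabla10 ρ (proj10 ρ X) Y p
    + proj10 ρ (bracket (antihol (proj01 ρ X)) (hol Y)) p
    + theta ρ p (X p) • proj10 ρ (bracket (reeb ρ) (hol Y)) p

/-- The curvature operator `R(X, Y) Z = ∇_X ∇_Y Z - ∇_Y ∇_X Z - ∇_{[X,Y]} Z`. -/
def curv {n : ℕ} (ρ : Cn n → ℝ) (X Y : CField n) (Z : Cn n → Cn n) : Cn n → Cn n := fun p =>
  nabla ρ X (nabla ρ Y Z) p - nabla ρ Y (nabla ρ X Z) p - nabla ρ (bracket X Y) Z p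

/-- The Tanaka–Webster curvature `R_{αβ̄γσ̄} = ⟨R(Z_γ, Z_σ̄) Z_α, Z_β̄⟩` at `p`, for
`(1,0)`-fields `Z_α = A`, `Z_β = B`, `Z_γ = C`, `Z_σ = D`. -/
def curvTensor {n : ℕ} (ρ : Cn n → ℝ) (A B C D : Cn n → Cn n) (p : Cn n) : ℂ :=
  levi ρ p (curv ρ (hol C) (conjField D) A p) (B p)

/-- Webster's holomorphic sectional curvature `K(Z) = ½ R(Z, Z̄, Z, Z̄) / |Z|⁴` at `p`
(a real number). -/
def holSecCurv {n : ℕ} (ρ : Cn n → ℝ) (Z : Cn n → Cn n) (p : Cn n) : ℝ :=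
  (1 / 2) * (curvTensor ρ Z Z Z Z p).re / ((levi ρ p (Z p) (Z p)).re) ^ 2

/-- The Levi matrix `h_{αβ̄} = ⟨Z_α, Z_β̄⟩` of a frame. -/
def frameMat {n : ℕ} (ρ : Cn n → ℝ) (Z : Fin n → Cn n → Cn n) (p : Cn n) :
    Matrix (Fin n) (Fin n) ℂ :=
  fun α β => levi ρ p (Z α p) (Z β p)

/-- The Tanaka–Webster scalar curvature `R = h^{αβ̄} h^{γσ̄} R_{αβ̄γσ̄}` at `p` (a real number),
computed in a frame of `T^{1,0}`; `h^{αβ̄}` is the inverse transpose of the Levi matrix. -/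
def scalarCurv {n : ℕ} (ρ : Cn n → ℝ) (Z : Fin n → Cn n → Cn n) (p : Cn n) : ℝ :=
  (∑ α, ∑ β, ∑ γ, ∑ σ, (frameMat ρ Z p)⁻¹ β α * (frameMat ρ Z p)⁻¹ σ γ *
    curvTensor ρ (Z α) (Z β) (Z γ) (Z σ) p).re

/-! ### Hypersurfaces, sections of `T^{1,0}`, convexity, ellipsoids -/

/-- The hypersurface `{ρ = 0}` in the domain `U` of `ρ`. -/
def zeroSet {n : ℕ} (U : Set (Cn n)) (ρ : Cn n → ℝ) : Set (Cn n) := {p ∈ U | ρ p = 0}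

/-- `Z` is (a smooth extension of) a smooth section near `p` of `T^{1,0}M`, `M = {ρ = 0}`:
the field `∑ Z_j ∂/∂z_j` is tangent to `M` at the points of `M` near `p`. -/
def IsSectionAt {n : ℕ} (ρ : Cn n → ℝ) (Z : Cn n → Cn n) (p : Cn n) : Prop :=
  ContDiffAt ℝ ∞ Z p ∧ ∀ᶠ q in 𝓝 p, ρ q = 0 → rhoD ρ q ⬝ᵥ Z q = 0

/-- `Z_1, …, Z_n` is a local frame of `T^{1,0}M` near `p`. -/
def IsFrameAt {n : ℕ} (ρ : Cn n → ℝ) (Z : Fin n → Cn n → Cn n) (p : Cn n) : Prop :=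
  (∀ α, IsSectionAt ρ (Z α) p) ∧ LinearIndependent ℂ fun α => Z α p

/-- The Hessian `Hess_ρ(p; η) = Re ∑ ρ_{jk} η_j η_k + ∑ ρ_{jk̄} η_j η̄_k`. -/
def hess {n : ℕ} (ρ : Cn n → ℝ) (p η : Cn n) : ℝ :=
  (∑ j, ∑ k, rhoDD ρ p j k * η j * η k).re + (∑ j, ∑ k, leviMat ρ p j k * η j * star (η k)).re

/-- `{ρ = 0}` is `ℂ`-convex: the Hessian of `ρ` is positive semidefinite on the complex tangent
space at every point. -/
def IsCConvex {n : ℕ} (U : Set (Cn n)) (ρ : Cn n → ℝ) : Prop :=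
  ∀ p ∈ zeroSet U ρ, ∀ η : Cn n, rhoD ρ p ⬝ᵥ η = 0 → 0 ≤ hess ρ p η

/-- `|∂ρ|² = ∑ a^{jk̄} ρ_j ρ_k̄`, with `a^{jk̄}` the inverse transpose of `a_{jk̄}`. -/
def normSqD {n : ℕ} (a : Matrix (Fin (n + 1)) (Fin (n + 1)) ℂ) (ρ : Cn n → ℝ) (p : Cn n) : ℝ :=
  (∑ j, ∑ k, a⁻¹ k j * rhoD ρ p j * rhoDbar ρ p k).re

/-- The defining function `∑ (a_j x_j² + b_j y_j²) - 1`, `z_j = x_j + i y_j`, of an ellipsoid. -/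
def ellipsoidFn {n : ℕ} (a b : Fin (n + 1) → ℝ) (z : Cn n) : ℝ :=
  ∑ j, (a j * (z j).re ^ 2 + b j * (z j).im ^ 2) - 1

end Pseudohermitian

end

open Pseudohermitian

/-!
Where the first derivatives of `ρ_{jk̄}` vanish along `M`, the Tanaka–Webster connection is the
componentwise derivative corrected by a multiple of the normal `ξ = (∂̄ρ)^♯`. Differentiating twice
gives a Gauss equation with `H(Z, W) = ∑ ρ_{jk} Z_j W_k` as second fundamental form: the curvature
is
`R(A, B̄, C, D̄) = (⟨A, D̄⟩⟨C, B̄⟩ + ⟨C, D̄⟩⟨A, B̄⟩ - H(C, A) conj H(D, B)) / |∂ρ|²`.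
Applied to `Z - W` and `i (Z + W)`, `ℂ`-convexity says `2 Re H(Z, W) ≤ |Z|² + |W|²`, so `H` is
dominated by the Levi form. Hence `R(Z, Z̄, Z, Z̄) ≥ |Z|⁴ / |∂ρ|²`, and, taking traces, the scalar
curvature is at least `(n (n + 1) - n) / |∂ρ|² = n² / |∂ρ|²`. Ellipsoids are `ℂ`-convex with
constant `ρ_{jk̄}`.
-/

namespace Pseudohermitian

open Complex Matrix

section ComplexDerivative

variable {n : ℕ} {E F G : Type*}
  [NormedAddCommGroup E] [NormedSpace ℝ E] [NormedSpace ℂ E] [IsScalarTower ℝ ℂ E]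
  [NormedAddCommGroup F] [NormedSpace ℝ F] [NormedSpace ℂ F] [IsScalarTower ℝ ℂ F]
  [NormedAddCommGroup G] [NormedSpace ℝ G] [NormedSpace ℂ G] [IsScalarTower ℝ ℂ G]
  {f g : Cn n → E} {q : Cn n}

/-- The differential of `f` at `q`, extended complex linearly to `ℂ ⊗ T_q ℂⁿ⁺¹`. The vector
`∑ u_j ∂/∂z_j + ∑ v_j ∂/∂z̄_j` is encoded as `(u, v)`, and it equals `x + i y` for the real vectors
`x = (u + v̄) / 2` and `y = (u - v̄) / (2i)`. -/
noncomputable def complexDeriv (f : Cn n → E) (q : Cn n) : Cn n × Cn n →ₗ[ℂ] E where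
  toFun w := (1 / 2 : ℂ) • (fderiv ℝ f q (w.1 + star w.2) - I • fderiv ℝ f q (I • (w.1 - star w.2)))
  map_add' w w' := by
    simp only [Prod.fst_add, Prod.snd_add, star_add, smul_add, smul_sub, map_add, map_sub]
    module
  map_smul' c w := by
    have h₁ : c • w.1 + star (c • w.2) =
        c.re • (w.1 + star w.2) + c.im • (I • (w.1 - star w.2)) := by
      ext j; apply Complex.ext <;> simp <;> ring
    have h₂ : I • (c • w.1 - star (c • w.2)) =
        c.re • (I • (w.1 - star w.2)) - c.im • (w.1 + star w.2) := by
      ext j; apply Complex.ext <;> simp <;> ring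
    have hsmul (r : ℝ) (e : E) : r • e = (r : ℂ) • e := (algebraMap_smul ℂ r e).symm
    simp only [Prod.smul_fst, Prod.smul_snd, h₁, h₂, map_add, map_sub, map_smul, hsmul,
      RingHom.id_apply]
    conv_rhs => rw [← c.re_add_im]
    match_scalars
    · ring
    · ring
    · linear_combination (c.im / 2 : ℂ) * I_mul_I

theorem complexDeriv_apply (f : Cn n → E) (q : Cn n) (w : Cn n × Cn n) :
    complexDeriv f q w =
      (1 / 2 : ℂ) • (fderiv ℝ f q (w.1 + star w.2) - I • fderiv ℝ f q (I • (w.1 - star w.2))) :=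
  rfl

theorem complexDeriv_self_star (f : Cn n → E) (q v : Cn n) :
    complexDeriv f q (v, star v) = fderiv ℝ f q v := by
  rw [complexDeriv_apply, star_star, sub_self, smul_zero, map_zero, smul_zero, sub_zero, map_add]
  module

theorem complexDeriv_of_fderiv_eq_zero (h : fderiv ℝ f q = 0) (w : Cn n × Cn n) :
    complexDeriv f q w = 0 := by
  simp [complexDeriv_apply, h]

theorem complexDeriv_const (e : E) (q : Cn n) (w : Cn n × Cn n) :
    complexDeriv (fun _ => e) q w = 0 :=
  complexDeriv_of_fderiv_eq_zero (fderiv_const_apply e) w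

theorem complexDeriv_congr (h : f =ᶠ[𝓝 q] g) : complexDeriv f q = complexDeriv g q :=
  LinearMap.ext fun w => by rw [complexDeriv_apply, complexDeriv_apply, h.fderiv_eq]

theorem complexDeriv_add (hf : DifferentiableAt ℝ f q) (hg : DifferentiableAt ℝ g q)
    (w : Cn n × Cn n) :
    complexDeriv (fun z => f z + g z) q w = complexDeriv f q w + complexDeriv g q w := by
  simp only [complexDeriv_apply, fderiv_fun_add hf hg, _root_.add_apply]
  module

theorem complexDeriv_sub (hf : DifferentiableAt ℝ f q) (hg : DifferentiableAt ℝ g q)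
    (w : Cn n × Cn n) :
    complexDeriv (fun z => f z - g z) q w = complexDeriv f q w - complexDeriv g q w := by
  simp only [complexDeriv_apply, fderiv_fun_sub hf hg, _root_.sub_apply]
  module

theorem complexDeriv_clm_comp (L : E →L[ℂ] F) (hf : DifferentiableAt ℝ f q) (w : Cn n × Cn n) :
    complexDeriv (fun z => L (f z)) q w = L (complexDeriv f q w) := by
  have h : fderiv ℝ (fun z => L (f z)) q = (L.restrictScalars ℝ).comp (fderiv ℝ f q) :=
    ((L.restrictScalars ℝ).hasFDerivAt.comp q hf.hasFDerivAt).fderiv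
  simp [complexDeriv_apply, h]

theorem complexDeriv_bilin (B : E →L[ℂ] F →L[ℂ] G) {g : Cn n → F} (hf : DifferentiableAt ℝ f q)
    (hg : DifferentiableAt ℝ g q) (w : Cn n × Cn n) :
    complexDeriv (fun z => B (f z) (g z)) q w =
      B (complexDeriv f q w) (g q) + B (f q) (complexDeriv g q w) := by
  have h (v : Cn n) : fderiv ℝ (fun z => B (f z) (g z)) q v =
      B (f q) (fderiv ℝ g q v) + B (fderiv ℝ f q v) (g q) :=
    DFunLike.congr_fun ((B.bilinearRestrictScalars ℝ).hasFDerivAt_of_bilinear hf.hasFDerivAt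
      hg.hasFDerivAt).fderiv v
  simp only [complexDeriv_apply, h, map_smul, map_sub, _root_.smul_apply, _root_.sub_apply]
  module

theorem complexDeriv_smul {s : Cn n → ℂ} (hs : DifferentiableAt ℝ s q)
    (hf : DifferentiableAt ℝ f q) (w : Cn n × Cn n) :
    complexDeriv (fun z => s z • f z) q w =
      complexDeriv s q w • f q + s q • complexDeriv f q w :=
  complexDeriv_bilin (ContinuousLinearMap.lsmul ℂ ℂ) hs hf w

theorem complexDeriv_dotProduct {ι : Type*} [Fintype ι] {u v : Cn n → ι → ℂ}
    (hu : DifferentiableAt ℝ u q) (hv : DifferentiableAt ℝ v q) (w : Cn n × Cn n) :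
    complexDeriv (fun z => u z ⬝ᵥ v z) q w =
      complexDeriv u q w ⬝ᵥ v q + u q ⬝ᵥ complexDeriv v q w :=
  complexDeriv_bilin (dotProductBilin ℂ ℂ : (ι → ℂ) →ₗ[ℂ] (ι → ℂ) →ₗ[ℂ] ℂ).toContinuousBilinearMap
    hu hv w

theorem complexDeriv_apply_apply {ι : Type*} [Fintype ι] {u : Cn n → ι → ℂ}
    (hu : DifferentiableAt ℝ u q) (w : Cn n × Cn n) (i : ι) :
    complexDeriv u q w i = complexDeriv (fun z => u z i) q w :=
  (complexDeriv_clm_comp (ContinuousLinearMap.proj (R := ℂ) i) hu w).symm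

theorem complexDeriv_prodMk {g : Cn n → F} (hf : DifferentiableAt ℝ f q)
    (hg : DifferentiableAt ℝ g q) (w : Cn n × Cn n) :
    complexDeriv (fun z => (f z, g z)) q w = (complexDeriv f q w, complexDeriv g q w) := by
  simp [complexDeriv_apply, hf.fderiv_prodMk hg]

theorem complexDeriv_star [StarAddMonoid E] [StarModule ℝ E] [StarModule ℂ E] [ContinuousStar E]
    (f : Cn n → E) (q v w : Cn n) :
    complexDeriv (fun z => star (f z)) q (v, w) = star (complexDeriv f q (star w, star v)) := by
  have hsub : star w - v = -(v - star w) := (neg_sub _ _).symm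
  simp only [complexDeriv_apply, fderiv_star, ContinuousLinearMap.comp_apply, star_star, star_smul,
    star_sub, add_comm (star w) v, hsub, smul_neg, map_neg, star_neg]
  simp

theorem differentiableAt_hol {Z : Cn n → Cn n} (hZ : DifferentiableAt ℝ Z q) :
    DifferentiableAt ℝ (hol Z) q :=
  hZ.prodMk (differentiableAt_const 0)

theorem differentiableAt_antihol {W : Cn n → Cn n} (hW : DifferentiableAt ℝ W q) :
    DifferentiableAt ℝ (antihol W) q :=
  (differentiableAt_const 0).prodMk hW

theorem complexDeriv_hol {Z : Cn n → Cn n} (hZ : DifferentiableAt ℝ Z q) (w : Cn n × Cn n) :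
    complexDeriv (hol Z) q w = (complexDeriv Z q w, 0) := by
  rw [← complexDeriv_const (0 : Cn n) q w]
  exact complexDeriv_prodMk hZ (differentiableAt_const 0) w

theorem complexDeriv_antihol {W : Cn n → Cn n} (hW : DifferentiableAt ℝ W q) (w : Cn n × Cn n) :
    complexDeriv (antihol W) q w = (0, complexDeriv W q w) := by
  rw [← complexDeriv_const (0 : Cn n) q w]
  exact complexDeriv_prodMk (differentiableAt_const 0) hW w

theorem contDiffAt_star {ι : Type*} [Fintype ι] {u : Cn n → ι → ℂ} (hu : ContDiffAt ℝ ∞ u q) :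
    ContDiffAt ℝ ∞ (fun z => star (u z)) q :=
  (starL' ℝ : (ι → ℂ) ≃L[ℝ] (ι → ℂ)).contDiff.contDiffAt.comp q hu

theorem contDiffAt_complexDeriv {X : CField n} (hf : ContDiffAt ℝ ∞ f q)
    (hX : ContDiffAt ℝ ∞ X q) : ContDiffAt ℝ ∞ (fun z => complexDeriv f z (X z)) q := by
  have hf' : ContDiffAt ℝ ∞ (fderiv ℝ f) q := hf.fderiv_right le_rfl
  have hX₂ : ContDiffAt ℝ ∞ (fun z => star (X z).2) q :=
    contDiffAt_star hX.snd
  exact ((hf'.clm_apply (hX.fst.add hX₂)).sub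
    ((hf'.clm_apply ((hX.fst.sub hX₂).const_smul I)).const_smul I)).const_smul (1 / 2 : ℂ)

theorem dz_eq_complexDeriv (f : Cn n → ℂ) (j : Fin (n + 1)) (q : Cn n) :
    dz f j q = complexDeriv f q (Pi.single j 1, 0) := by
  simp only [dz, complexDeriv_apply, star_zero, add_zero, sub_zero, ← Pi.single_smul, smul_eq_mul,
    mul_one]
  ring

theorem dzbar_eq_complexDeriv (f : Cn n → ℂ) (j : Fin (n + 1)) (q : Cn n) :
    dzbar f j q = complexDeriv f q (0, Pi.single j 1) := by
  simp only [dzbar, complexDeriv_apply, Pi.star_single, star_one, zero_add, zero_sub, smul_neg,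
    ← Pi.single_smul, smul_eq_mul, mul_one, map_neg]
  ring

theorem lieD_eq_complexDeriv (X : CField n) (f : Cn n → ℂ) (q : Cn n) :
    lieD X f q = complexDeriv f q (X q) := by
  have hX : X q = ∑ j, ((X q).1 j • (Pi.single j 1, 0) + (X q).2 j • (0, Pi.single j 1)) := by
    ext j <;> simp [Prod.fst_sum, Prod.snd_sum, Pi.single_apply]
  rw [hX, map_sum]
  simp only [map_add, map_smul, lieD, dz_eq_complexDeriv, dzbar_eq_complexDeriv, smul_eq_mul]

theorem bracket_eq {X Y : CField n} (hX : DifferentiableAt ℝ X q) (hY : DifferentiableAt ℝ Y q) :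
    bracket X Y q = complexDeriv Y q (X q) - complexDeriv X q (Y q) := by
  have hcomp (L : Cn n × Cn n →L[ℂ] ℂ) {V : CField n} (hV : DifferentiableAt ℝ V q)
      (W : CField n) : lieD W (fun z => L (V z)) q = L (complexDeriv V q (W q)) := by
    rw [lieD_eq_complexDeriv, complexDeriv_clm_comp L hV]
  ext k
  · let L : Cn n × Cn n →L[ℂ] ℂ := (ContinuousLinearMap.proj k).comp (ContinuousLinearMap.fst ℂ _ _)
    exact congr_arg₂ (· - ·) (hcomp L hY X) (hcomp L hX Y)
  · let L : Cn n × Cn n →L[ℂ] ℂ := (ContinuousLinearMap.proj k).comp (ContinuousLinearMap.snd ℂ _ _)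
    exact congr_arg₂ (· - ·) (hcomp L hY X) (hcomp L hX Y)

theorem differentiableAt_complexDeriv {Y : CField n} (hf : ContDiffAt ℝ 2 f q)
    (hY : DifferentiableAt ℝ Y q) : DifferentiableAt ℝ (fun z => complexDeriv f z (Y z)) q := by
  have hf' : DifferentiableAt ℝ (fderiv ℝ f) q :=
    (hf.fderiv_right (m := 1) le_rfl).differentiableAt one_ne_zero
  have hY₂ : DifferentiableAt ℝ (fun z => star (Y z).2) q := hY.snd.star
  exact ((hf'.clm_apply (hY.fst.add hY₂)).sub
    ((hf'.clm_apply ((hY.fst.sub hY₂).const_smul I)).const_smul I)).const_smul (1 / 2 : ℂ)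

theorem fderiv_complexDeriv {Y : CField n} (hf : ContDiffAt ℝ 2 f q)
    (hY : DifferentiableAt ℝ Y q) (v : Cn n) :
    fderiv ℝ (fun z => complexDeriv f z (Y z)) q v =
      (1 / 2 : ℂ) • (fderiv ℝ (fderiv ℝ f) q v ((Y q).1 + star (Y q).2) -
        I • fderiv ℝ (fderiv ℝ f) q v (I • ((Y q).1 - star (Y q).2))) +
      complexDeriv f q (fderiv ℝ Y q v) := by
  let c : Cn n ≃L[ℝ] Cn n := starL' ℝ
  let P : Cn n × Cn n →L[ℝ] Cn n := .fst ℝ _ _ + c.toContinuousLinearMap.comp (.snd ℝ _ _)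
  let N : Cn n × Cn n →L[ℝ] Cn n := I • (.fst ℝ _ _ - c.toContinuousLinearMap.comp (.snd ℝ _ _))
  have hD : HasFDerivAt (fderiv ℝ f) (fderiv ℝ (fderiv ℝ f) q) q :=
    ((hf.fderiv_right (m := 1) le_rfl).differentiableAt one_ne_zero).hasFDerivAt
  have hcomp (L : Cn n × Cn n →L[ℝ] Cn n) := hD.clm_apply (L.hasFDerivAt.comp q hY.hasFDerivAt)
  have h : fderiv ℝ (fun z => complexDeriv f z (Y z)) q v = _ :=
    DFunLike.congr_fun
      (((hcomp P).sub ((hcomp N).const_smul I)).const_smul (1 / 2 : ℂ)).fderiv v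
  rw [h, complexDeriv_apply]
  simp only [P, N, c, ContinuousLinearMap.comp_apply, ContinuousLinearMap.flip_apply,
    ContinuousLinearMap.coe_fst', ContinuousLinearMap.coe_snd', ContinuousLinearEquiv.coe_coe,
    starL'_apply, Function.comp_apply, _root_.smul_apply, _root_.sub_apply, _root_.add_apply,
    map_add]
  module

theorem complexDeriv_complexDeriv {Y : CField n} (hf : ContDiffAt ℝ 2 f q)
    (hY : DifferentiableAt ℝ Y q) (w : Cn n × Cn n) :
    complexDeriv (fun z => complexDeriv f z (Y z)) q w =
      complexDeriv (fun z => complexDeriv f z (Y q)) q w +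
        complexDeriv f q (complexDeriv Y q w) := by
  have h (v : Cn n) := fderiv_complexDeriv hf (differentiableAt_const (Y q)) v
  simp only [complexDeriv_apply _ q w, fderiv_complexDeriv hf hY, h, map_smul, map_sub,
    fderiv_fun_const, Pi.zero_apply, _root_.zero_apply, map_zero, add_zero]
  module

theorem complexDeriv_complexDeriv_comm (hf : ContDiffAt ℝ 2 f q) (v w : Cn n × Cn n) :
    complexDeriv (fun z => complexDeriv f z v) q w =
      complexDeriv (fun z => complexDeriv f z w) q v := by
  have h (u : Cn n × Cn n) (x : Cn n) := fderiv_complexDeriv hf (differentiableAt_const u) x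
  have hsymm : IsSymmSndFDerivAt ℝ f q := hf.isSymmSndFDerivAt (by simp)
  simp only [complexDeriv_apply _ q v, complexDeriv_apply _ q w, h, fderiv_fun_const,
    Pi.zero_apply, _root_.zero_apply, map_zero, add_zero]
  rw [hsymm.eq (v.1 + _), hsymm.eq (v.1 + _), hsymm.eq (I • (v.1 - _)), hsymm.eq (I • (v.1 - _))]
  module

theorem complexDeriv_bracket {X Y : CField n} (hf : ContDiffAt ℝ 2 f q)
    (hX : DifferentiableAt ℝ X q) (hY : DifferentiableAt ℝ Y q) :
    complexDeriv f q (bracket X Y q) =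
      complexDeriv (fun z => complexDeriv f z (Y z)) q (X q) -
        complexDeriv (fun z => complexDeriv f z (X z)) q (Y q) := by
  rw [bracket_eq hX hY, map_sub, complexDeriv_complexDeriv hf hX, complexDeriv_complexDeriv hf hY,
    complexDeriv_complexDeriv_comm hf (Y q)]
  abel

end ComplexDerivative

section LevelSet

theorem fderiv_apply_eq_zero_of_eqOn_fiber {E F G : Type*} [NormedAddCommGroup E] [NormedSpace ℝ E]
    [CompleteSpace E] [NormedAddCommGroup F] [NormedSpace ℝ F] [FiniteDimensional ℝ F]
    [NormedAddCommGroup G] [NormedSpace ℝ G] {φ : E → F} {φ' : E →L[ℝ] F} {f : E → G} {q v : E}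
    (hφ : HasStrictFDerivAt φ φ' q) (hφ' : φ'.range = ⊤) (hf : DifferentiableAt ℝ f q)
    (hfφ : ∀ᶠ z in 𝓝 q, φ z = φ q → f z = 0) (hv : φ' v = 0) : fderiv ℝ f q v = 0 := by
  let γ : φ'.ker → E := hφ.implicitFunction φ φ' hφ' (φ q)
  have hγ0 : γ 0 = q := hφ.implicitFunction_apply_image hφ'
  have hγ : HasFDerivAt γ φ'.ker.subtypeL 0 := (hφ.to_implicitFunction hφ').hasFDerivAt
  have hφγ : ∀ᶠ y in 𝓝 0, φ (γ y) = φ q :=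
    (Continuous.prodMk_right (φ q)).continuousAt.eventually (hφ.map_implicitFunction_eq hφ')
  have hfφγ : ∀ᶠ z in 𝓝 (γ 0), φ z = φ q → f z = 0 := by rwa [hγ0]
  have hfγ : f ∘ γ =ᶠ[𝓝 0] fun _ => 0 := by
    filter_upwards [hφγ, hγ.continuousAt.eventually hfφγ] with y hy hfy using hfy hy
  have hf' : HasFDerivAt f (fderiv ℝ f q) (γ 0) := by rw [hγ0]; exact hf.hasFDerivAt
  have hcomp : HasFDerivAt (f ∘ γ) ((fderiv ℝ f q).comp φ'.ker.subtypeL) 0 := hf'.comp 0 hγ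
  exact DFunLike.congr_fun
    (hcomp.unique ((hasFDerivAt_const 0 0).congr_of_eventuallyEq hfγ)) ⟨v, hv⟩

variable {n : ℕ} {ρ : Cn n → ℝ} {q : Cn n} {E : Type*}
  [NormedAddCommGroup E] [NormedSpace ℝ E] [NormedSpace ℂ E] [IsScalarTower ℝ ℂ E]

theorem fderiv_ofReal_comp (hρ : DifferentiableAt ℝ ρ q) (v : Cn n) :
    fderiv ℝ (fun z => (ρ z : ℂ)) q v = (fderiv ℝ ρ q v : ℂ) :=
  DFunLike.congr_fun (ofRealCLM.hasFDerivAt.comp q hρ.hasFDerivAt).fderiv v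

theorem complexDeriv_eq_zero_of_eqOn_level {f : Cn n → E} {w : Cn n × Cn n}
    (hρ : ContDiffAt ℝ ∞ ρ q) (hd : fderiv ℝ ρ q ≠ 0) (h₀ : ρ q = 0)
    (hf : DifferentiableAt ℝ f q) (hfρ : ∀ᶠ z in 𝓝 q, ρ z = 0 → f z = 0)
    (hw : complexDeriv (fun z => (ρ z : ℂ)) q w = 0) : complexDeriv f q w = 0 := by
  have hdiff : DifferentiableAt ℝ ρ q := hρ.differentiableAt (by simp)
  have htangent (v : Cn n) (hv : fderiv ℝ ρ q v = 0) : fderiv ℝ f q v = 0 :=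
    fderiv_apply_eq_zero_of_eqOn_fiber (hρ.hasStrictFDerivAt (by simp))
      (Module.Dual.range_eq_top_of_ne_zero fun h => hd (ContinuousLinearMap.coe_injective h)) hf
      (by simpa only [h₀] using hfρ) hv
  have hzero (x y : ℝ) (h : (1 / 2 : ℂ) • ((x : ℂ) - I • (y : ℂ)) = 0) : x = 0 ∧ y = 0 := by
    simpa [Complex.ext_iff] using h
  rw [complexDeriv_apply, fderiv_ofReal_comp hdiff, fderiv_ofReal_comp hdiff] at hw
  obtain ⟨hre, him⟩ := hzero _ _ hw
  rw [complexDeriv_apply, htangent _ hre, htangent _ him, smul_zero, sub_zero, smul_zero]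

theorem complexDeriv_congr_of_eqOn_level {f g : Cn n → E} {w : Cn n × Cn n}
    (hρ : ContDiffAt ℝ ∞ ρ q) (hd : fderiv ℝ ρ q ≠ 0) (h₀ : ρ q = 0)
    (hf : DifferentiableAt ℝ f q) (hg : DifferentiableAt ℝ g q)
    (hfg : ∀ᶠ z in 𝓝 q, ρ z = 0 → f z = g z)
    (hw : complexDeriv (fun z => (ρ z : ℂ)) q w = 0) :
    complexDeriv f q w = complexDeriv g q w := by
  rw [← sub_eq_zero, ← complexDeriv_sub hf hg]
  exact complexDeriv_eq_zero_of_eqOn_level hρ hd h₀ (hf.sub hg)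
    (hfg.mono fun z hz hρz => sub_eq_zero.2 (hz hρz)) hw

end LevelSet

section DefiningFunction

variable {n : ℕ} {ρ : Cn n → ℝ} {q : Cn n}

theorem complexDeriv_ofReal (ρ : Cn n → ℝ) (q : Cn n) (w : Cn n × Cn n) :
    complexDeriv (fun z => (ρ z : ℂ)) q w = rhoD ρ q ⬝ᵥ w.1 + rhoDbar ρ q ⬝ᵥ w.2 := by
  rw [← lieD_eq_complexDeriv (fun _ => w)]
  simp only [lieD, Finset.sum_add_distrib, dotProduct, rhoD, rhoDbar, mul_comm]

theorem rhoDbar_eq_star_rhoD (ρ : Cn n → ℝ) (q : Cn n) : rhoDbar ρ q = star (rhoD ρ q) := by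
  ext k
  have h := complexDeriv_star (fun z => (ρ z : ℂ)) q 0 (Pi.single k 1)
  simpa [rhoD, rhoDbar, dz_eq_complexDeriv, dzbar_eq_complexDeriv, ← Pi.single_star] using h

theorem rhoDbar_dotProduct_star (ρ : Cn n → ℝ) (q v : Cn n) :
    rhoDbar ρ q ⬝ᵥ star v = star (rhoD ρ q ⬝ᵥ v) := by
  rw [rhoDbar_eq_star_rhoD, star_dotProduct_star, dotProduct_comm]

theorem complexDeriv_fst_zero_eq_vecMul {u : Cn n → Cn n} (hu : DifferentiableAt ℝ u q)
    (v : Cn n) :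
    complexDeriv u q (v, 0) = v ᵥ* Matrix.of fun j k => dz (fun z => u z k) j q := by
  ext k
  rw [complexDeriv_apply_apply hu, ← lieD_eq_complexDeriv fun _ => (v, 0)]
  simp [lieD, vecMul, dotProduct]

theorem contDiffAt_ofReal (hρ : ContDiffAt ℝ ∞ ρ q) : ContDiffAt ℝ ∞ (fun z => (ρ z : ℂ)) q :=
  ofRealCLM.contDiff.contDiffAt.comp q hρ

theorem contDiffAt_rhoD (hρ : ContDiffAt ℝ ∞ ρ q) : ContDiffAt ℝ ∞ (rhoD ρ) q :=
  contDiffAt_pi.2 fun j => by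
    simpa only [rhoD, dz_eq_complexDeriv] using
      contDiffAt_complexDeriv (contDiffAt_ofReal hρ) contDiffAt_const

theorem contDiffAt_rhoDbar (hρ : ContDiffAt ℝ ∞ ρ q) : ContDiffAt ℝ ∞ (rhoDbar ρ) q := by
  simpa only [funext (rhoDbar_eq_star_rhoD ρ)] using contDiffAt_star (contDiffAt_rhoD hρ)

theorem complexDeriv_rhoD_fst (hρ : ContDiffAt ℝ ∞ ρ q) (v : Cn n) :
    complexDeriv (rhoD ρ) q (v, 0) = v ᵥ* rhoDD ρ q :=
  complexDeriv_fst_zero_eq_vecMul ((contDiffAt_rhoD hρ).differentiableAt (by simp)) v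

theorem complexDeriv_rhoDbar_fst (hρ : ContDiffAt ℝ ∞ ρ q) (v : Cn n) :
    complexDeriv (rhoDbar ρ) q (v, 0) = v ᵥ* leviMat ρ q :=
  complexDeriv_fst_zero_eq_vecMul ((contDiffAt_rhoDbar hρ).differentiableAt (by simp)) v

theorem complexDeriv_rhoD_snd (hρ : ContDiffAt ℝ ∞ ρ q) (v : Cn n) :
    complexDeriv (rhoD ρ) q (0, star v) = star (v ᵥ* leviMat ρ q) := by
  have h := complexDeriv_star (rhoDbar ρ) q 0 (star v)
  simpa only [rhoDbar_eq_star_rhoD, star_star, star_zero, complexDeriv_rhoDbar_fst hρ] using h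

theorem complexDeriv_rhoDbar_snd (hρ : ContDiffAt ℝ ∞ ρ q) (v : Cn n) :
    complexDeriv (rhoDbar ρ) q (0, star v) = star (v ᵥ* rhoDD ρ q) := by
  have h := complexDeriv_star (rhoD ρ) q 0 (star v)
  simpa only [← rhoDbar_eq_star_rhoD, star_star, star_zero, complexDeriv_rhoD_fst hρ] using h

theorem rhoDD_apply_comm (hρ : ContDiffAt ℝ ∞ ρ q) (j k : Fin (n + 1)) :
    rhoDD ρ q j k = rhoDD ρ q k j := by
  simpa only [rhoDD, rhoD, dz_eq_complexDeriv] using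
    complexDeriv_complexDeriv_comm ((contDiffAt_ofReal hρ).of_le ENat.LEInfty.out)
      (Pi.single k 1, 0) (Pi.single j 1, 0)

theorem isHermitian_leviMat (hρ : ContDiffAt ℝ ∞ ρ q) : (leviMat ρ q).IsHermitian := by
  refine IsHermitian.ext fun j k => ?_
  have hsnd := congr_fun (complexDeriv_rhoD_snd hρ (Pi.single k 1)) j
  rw [complexDeriv_apply_apply ((contDiffAt_rhoD hρ).differentiableAt (by simp)),
    ← Pi.single_star, star_one, single_one_vecMul, Pi.star_apply] at hsnd
  refine hsnd.symm.trans ?_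
  simpa only [leviMat, rhoD, rhoDbar, dz_eq_complexDeriv, dzbar_eq_complexDeriv] using
    complexDeriv_complexDeriv_comm ((contDiffAt_ofReal hρ).of_le ENat.LEInfty.out)
      (Pi.single j 1, 0) (0, Pi.single k 1)

theorem complexDeriv_ofReal_bracket_eq_zero {X Y : CField n} (hρ : ContDiffAt ℝ ∞ ρ q)
    (hd : fderiv ℝ ρ q ≠ 0) (h₀ : ρ q = 0)
    (hX : DifferentiableAt ℝ X q) (hY : DifferentiableAt ℝ Y q)
    (hXρ : ∀ᶠ z in 𝓝 q, ρ z = 0 → complexDeriv (fun z => (ρ z : ℂ)) z (X z) = 0)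
    (hYρ : ∀ᶠ z in 𝓝 q, ρ z = 0 → complexDeriv (fun z => (ρ z : ℂ)) z (Y z) = 0) :
    complexDeriv (fun z => (ρ z : ℂ)) q (bracket X Y q) = 0 := by
  have hρ₂ : ContDiffAt ℝ 2 (fun z => (ρ z : ℂ)) q :=
    (contDiffAt_ofReal hρ).of_le ENat.LEInfty.out
  rw [complexDeriv_bracket hρ₂ hX hY,
    complexDeriv_eq_zero_of_eqOn_level hρ hd h₀ (differentiableAt_complexDeriv hρ₂ hY) hYρ
      (hXρ.self_of_nhds h₀),
    complexDeriv_eq_zero_of_eqOn_level hρ hd h₀ (differentiableAt_complexDeriv hρ₂ hX) hXρ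
      (hYρ.self_of_nhds h₀), sub_zero]

end DefiningFunction

section Smoothness

variable {ι E : Type*} [Fintype ι] [NormedAddCommGroup E] [NormedSpace ℝ E] {q : E}

theorem contDiffAt_dotProduct {u v : E → ι → ℂ} (hu : ContDiffAt ℝ ∞ u q)
    (hv : ContDiffAt ℝ ∞ v q) : ContDiffAt ℝ ∞ (fun z => u z ⬝ᵥ v z) q :=
  ContDiffAt.sum fun i _ => (contDiffAt_pi.1 hu i).mul (contDiffAt_pi.1 hv i)

theorem differentiableAt_dotProduct {u v : E → ι → ℂ} (hu : DifferentiableAt ℝ u q)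
    (hv : DifferentiableAt ℝ v q) : DifferentiableAt ℝ (fun z => u z ⬝ᵥ v z) q :=
  .fun_sum fun i _ => (differentiableAt_pi.1 hu i).mul (differentiableAt_pi.1 hv i)

variable [DecidableEq ι] {A : E → Matrix ι ι ℂ}

theorem contDiffAt_matrix_det (hA : ∀ i j, ContDiffAt ℝ ∞ (fun z => A z i j) q) :
    ContDiffAt ℝ ∞ (fun z => (A z).det) q := by
  simp only [det_apply']
  exact ContDiffAt.sum fun σ _ => contDiffAt_const.mul (contDiffAt_prod fun i _ => hA _ _)

theorem contDiffAt_matrix_inv (hA : ∀ i j, ContDiffAt ℝ ∞ (fun z => A z i j) q)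
    (hdet : (A q).det ≠ 0) (i j : ι) : ContDiffAt ℝ ∞ (fun z => (A z)⁻¹ i j) q := by
  have hadj : ContDiffAt ℝ ∞ (fun z => (A z).adjugate i j) q := by
    simp only [adjugate_apply]
    refine contDiffAt_matrix_det fun k l => ?_
    by_cases hk : k = j
    · simpa only [updateRow_apply, if_pos hk] using contDiffAt_const
    · simpa only [updateRow_apply, if_neg hk] using hA k l
  simp only [Matrix.inv_def, Matrix.smul_apply, Ring.inverse_eq_inv', smul_eq_mul]
  exact ((contDiffAt_matrix_det hA).inv hdet).mul hadj

end Smoothness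

section ContDiff

variable {n : ℕ} {ρ : Cn n → ℝ} {q : Cn n}

theorem contDiffAt_lieD {X : CField n} {f : Cn n → ℂ} (hX : ContDiffAt ℝ ∞ X q)
    (hf : ContDiffAt ℝ ∞ f q) : ContDiffAt ℝ ∞ (lieD X f) q := by
  simpa only [funext (lieD_eq_complexDeriv X f)] using contDiffAt_complexDeriv hf hX

theorem contDiffAt_hol {Z : Cn n → Cn n} (hZ : ContDiffAt ℝ ∞ Z q) : ContDiffAt ℝ ∞ (hol Z) q :=
  hZ.prodMk contDiffAt_const

theorem contDiffAt_antihol {W : Cn n → Cn n} (hW : ContDiffAt ℝ ∞ W q) :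
    ContDiffAt ℝ ∞ (antihol W) q :=
  contDiffAt_const.prodMk hW

theorem contDiffAt_bracket {X Y : CField n} (hX : ContDiffAt ℝ ∞ X q)
    (hY : ContDiffAt ℝ ∞ Y q) : ContDiffAt ℝ ∞ (bracket X Y) q :=
  .prodMk
    (contDiffAt_pi.2 fun k => (contDiffAt_lieD hX (contDiffAt_pi.1 hY.fst k)).sub
      (contDiffAt_lieD hY (contDiffAt_pi.1 hX.fst k)))
    (contDiffAt_pi.2 fun k => (contDiffAt_lieD hX (contDiffAt_pi.1 hY.snd k)).sub
      (contDiffAt_lieD hY (contDiffAt_pi.1 hX.snd k)))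

theorem contDiffAt_leviMat (hρ : ContDiffAt ℝ ∞ ρ q) (j k : Fin (n + 1)) :
    ContDiffAt ℝ ∞ (fun z => leviMat ρ z j k) q := by
  simpa only [leviMat, dz_eq_complexDeriv] using
    contDiffAt_complexDeriv (contDiffAt_pi.1 (contDiffAt_rhoDbar hρ) k) contDiffAt_const

theorem contDiffAt_theta {X : CField n} (hρ : ContDiffAt ℝ ∞ ρ q) (hX : ContDiffAt ℝ ∞ X q) :
    ContDiffAt ℝ ∞ (fun z => theta ρ z (X z)) q :=
  contDiffAt_const.mul (contDiffAt_dotProduct (contDiffAt_rhoDbar hρ) hX.snd)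

/-- The squared length `|∂ρ|² = ∂ρ(ξ)` of `∂ρ` in the metric `ρ_{jk̄}`, as a complex number. -/
noncomputable def normalNormSq (ρ : Cn n → ℝ) (q : Cn n) : ℂ :=
  rhoD ρ q ⬝ᵥ normalVec ρ q

/-- The points `q` of `{ρ = 0}` near which the splitting of the complexified tangent bundle into
`T^{1,0}`, `T^{0,1}` and `ℂ T` is defined and smooth: `(ρ_{jk̄})` is invertible and `ξ` is
transversal to `T^{1,0}`. -/
structure IsNondegenerateAt (ρ : Cn n → ℝ) (q : Cn n) : Prop where
  contDiffAt : ContDiffAt ℝ ∞ ρ q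
  eq_zero : ρ q = 0
  det_leviMat_ne_zero : (leviMat ρ q).det ≠ 0
  normalNormSq_ne_zero : normalNormSq ρ q ≠ 0

namespace IsNondegenerateAt

variable {X : CField n} {Y : Cn n → Cn n} (h : IsNondegenerateAt ρ q)

include h

theorem fderiv_ne_zero : fderiv ℝ ρ q ≠ 0 := by
  intro h₀
  have hdiff : DifferentiableAt ℝ ρ q := h.contDiffAt.differentiableAt (by simp)
  have hderiv : fderiv ℝ (fun z => (ρ z : ℂ)) q = 0 := by
    ext v
    simp [fderiv_ofReal_comp hdiff, h₀]
  have hrhoD : rhoD ρ q = 0 := by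
    ext j
    rw [rhoD, dz_eq_complexDeriv, complexDeriv_of_fderiv_eq_zero hderiv, Pi.zero_apply]
  exact h.normalNormSq_ne_zero (by rw [normalNormSq, hrhoD, zero_dotProduct])

theorem contDiffAt_sharp {φ : Cn n → Cn n} (hφ : ContDiffAt ℝ ∞ φ q) :
    ContDiffAt ℝ ∞ (fun z => sharp ρ z (φ z)) q :=
  contDiffAt_pi.2 fun j => contDiffAt_dotProduct hφ (contDiffAt_pi.2 fun k =>
    contDiffAt_matrix_inv (contDiffAt_leviMat h.contDiffAt) h.det_leviMat_ne_zero k j)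

theorem contDiffAt_normalVec : ContDiffAt ℝ ∞ (normalVec ρ) q :=
  h.contDiffAt_sharp (contDiffAt_rhoDbar h.contDiffAt)

theorem contDiffAt_div_normalNormSq {f : Cn n → ℂ} (hf : ContDiffAt ℝ ∞ f q) :
    ContDiffAt ℝ ∞ (fun z => f z / normalNormSq ρ z) q := by
  simp only [div_eq_mul_inv]
  exact hf.mul ((contDiffAt_dotProduct (contDiffAt_rhoD h.contDiffAt) h.contDiffAt_normalVec).inv
    h.normalNormSq_ne_zero)

theorem contDiffAt_reeb10 : ContDiffAt ℝ ∞ (reeb10 ρ) q :=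
  (h.contDiffAt_div_normalNormSq contDiffAt_const).smul h.contDiffAt_normalVec

theorem contDiffAt_reeb : ContDiffAt ℝ ∞ (reeb ρ) q :=
  h.contDiffAt_reeb10.prodMk (contDiffAt_star h.contDiffAt_reeb10)

theorem contDiffAt_proj10 (hX : ContDiffAt ℝ ∞ X q) : ContDiffAt ℝ ∞ (proj10 ρ X) q :=
  hX.fst.sub ((contDiffAt_theta h.contDiffAt hX).smul h.contDiffAt_reeb.fst)

theorem contDiffAt_proj01 (hX : ContDiffAt ℝ ∞ X q) : ContDiffAt ℝ ∞ (proj01 ρ X) q :=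
  hX.snd.sub ((contDiffAt_theta h.contDiffAt hX).smul h.contDiffAt_reeb.snd)

theorem contDiffAt_nabla10 {X : Cn n → Cn n} (hX : ContDiffAt ℝ ∞ X q)
    (hY : ContDiffAt ℝ ∞ Y q) : ContDiffAt ℝ ∞ (nabla10 ρ X Y) q := by
  have hV : ContDiffAt ℝ ∞ (fun z => sharp ρ z fun k =>
      lieD (hol X) (fun q => ∑ j, leviMat ρ q j k * Y q j) z) q :=
    h.contDiffAt_sharp (contDiffAt_pi.2 fun k => contDiffAt_lieD (contDiffAt_hol hX)
      (ContDiffAt.sum fun j _ =>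
        (contDiffAt_leviMat h.contDiffAt j k).mul (contDiffAt_pi.1 hY j)))
  exact hV.sub ((h.contDiffAt_div_normalNormSq
    (contDiffAt_dotProduct (contDiffAt_rhoD h.contDiffAt) hV)).smul h.contDiffAt_normalVec)

theorem contDiffAt_nabla (hX : ContDiffAt ℝ ∞ X q) (hY : ContDiffAt ℝ ∞ Y q) :
    ContDiffAt ℝ ∞ (nabla ρ X Y) q :=
  ((h.contDiffAt_nabla10 (h.contDiffAt_proj10 hX) hY).add
    (h.contDiffAt_proj10 (contDiffAt_bracket
      (contDiffAt_antihol (h.contDiffAt_proj01 hX)) (contDiffAt_hol hY)))).add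
    ((contDiffAt_theta h.contDiffAt hX).smul (h.contDiffAt_proj10
      (contDiffAt_bracket h.contDiffAt_reeb (contDiffAt_hol hY))))

end IsNondegenerateAt

end ContDiff

section LeviForm

variable {n : ℕ} {ρ : Cn n → ℝ} {q : Cn n}

theorem levi_eq (ρ : Cn n → ℝ) (q Z W : Cn n) : levi ρ q Z W = Z ᵥ* leviMat ρ q ⬝ᵥ star W := by
  have h : levi ρ q Z W = ∑ j, ∑ k, leviMat ρ q j k * (Z j * star (W k)) := by
    simp only [levi, dtheta, Pi.zero_apply, mul_zero, sub_zero, Pi.star_apply]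
    rw [← mul_assoc, neg_mul, I_mul_I, neg_neg, one_mul]
  rw [h, Finset.sum_comm]
  simp only [dotProduct, vecMul, Finset.sum_mul, Pi.star_apply]
  exact Finset.sum_congr rfl fun k _ => Finset.sum_congr rfl fun j _ => by ring

theorem levi_add_left (ρ : Cn n → ℝ) (q Z Z' W : Cn n) :
    levi ρ q (Z + Z') W = levi ρ q Z W + levi ρ q Z' W := by
  simp only [levi_eq, add_vecMul, add_dotProduct]

theorem levi_sub_left (ρ : Cn n → ℝ) (q Z Z' W : Cn n) :
    levi ρ q (Z - Z') W = levi ρ q Z W - levi ρ q Z' W := by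
  simp only [levi_eq, sub_vecMul, sub_dotProduct]

theorem levi_smul_left (ρ : Cn n → ℝ) (q : Cn n) (c : ℂ) (Z W : Cn n) :
    levi ρ q (c • Z) W = c * levi ρ q Z W := by
  simp only [levi_eq, smul_vecMul, smul_dotProduct, smul_eq_mul]

theorem star_levi (hρ : ContDiffAt ℝ ∞ ρ q) (Z W : Cn n) :
    star (levi ρ q Z W) = levi ρ q W Z := by
  rw [levi_eq, levi_eq, ← star_dotProduct_star, star_star, star_vecMul,
    (isHermitian_leviMat hρ).eq, dotProduct_mulVec]

theorem differentiableAt_vecMul_leviMat {Y : Cn n → Cn n} (hρ : ContDiffAt ℝ ∞ ρ q)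
    (hY : DifferentiableAt ℝ Y q) : DifferentiableAt ℝ (fun z => Y z ᵥ* leviMat ρ z) q :=
  differentiableAt_pi.2 fun k => differentiableAt_dotProduct hY (differentiableAt_pi.2 fun j =>
    (contDiffAt_leviMat hρ j k).differentiableAt (by simp))

/-- The orthogonal projection onto `T^{1,0}` along `ξ`. -/
noncomputable def tangentPart (ρ : Cn n → ℝ) (q : Cn n) : Cn n →ₗ[ℂ] Cn n where
  toFun V := V - (rhoD ρ q ⬝ᵥ V / normalNormSq ρ q) • normalVec ρ q
  map_add' V W := by
    rw [dotProduct_add]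
    module
  map_smul' c V := by
    rw [dotProduct_smul, smul_eq_mul, RingHom.id_apply]
    module

theorem tangentPart_apply (ρ : Cn n → ℝ) (q V : Cn n) :
    tangentPart ρ q V = V - (rhoD ρ q ⬝ᵥ V / normalNormSq ρ q) • normalVec ρ q :=
  rfl

theorem tangentPart_eq_self {V : Cn n} (hV : rhoD ρ q ⬝ᵥ V = 0) : tangentPart ρ q V = V := by
  rw [tangentPart_apply, hV, zero_div, zero_smul, sub_zero]

theorem rhoD_dotProduct_reeb10 (hν : normalNormSq ρ q ≠ 0) : rhoD ρ q ⬝ᵥ reeb10 ρ q = I := by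
  rw [reeb10, dotProduct_smul, smul_eq_mul]
  exact div_mul_cancel₀ I hν

theorem rhoD_dotProduct_proj10 (hν : normalNormSq ρ q ≠ 0) (X : CField n) :
    rhoD ρ q ⬝ᵥ proj10 ρ X q = complexDeriv (fun z => (ρ z : ℂ)) q (X q) := by
  rw [complexDeriv_ofReal, proj10, dotProduct_sub, dotProduct_smul, reeb,
    rhoD_dotProduct_reeb10 hν, theta, smul_eq_mul, ← dotProduct]
  linear_combination -(rhoDbar ρ q ⬝ᵥ (X q).2) * I_mul_I

theorem rhoDbar_dotProduct_proj01 (hν : normalNormSq ρ q ≠ 0) (X : CField n) :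
    rhoDbar ρ q ⬝ᵥ proj01 ρ X q = 0 := by
  rw [proj01, dotProduct_sub, dotProduct_smul, reeb, rhoDbar_dotProduct_star,
    rhoD_dotProduct_reeb10 hν, theta, smul_eq_mul, ← dotProduct, star_def, conj_I]
  linear_combination (rhoDbar ρ q ⬝ᵥ (X q).2) * I_mul_I

theorem complexDeriv_ofReal_reeb (hν : normalNormSq ρ q ≠ 0) :
    complexDeriv (fun z => (ρ z : ℂ)) q (reeb ρ q) = 0 := by
  rw [complexDeriv_ofReal, reeb, rhoDbar_dotProduct_star, rhoD_dotProduct_reeb10 hν, star_def,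
    conj_I, add_neg_cancel]

theorem eq_proj10_add_proj01_add_reeb (ρ : Cn n → ℝ) (X : CField n) (q : Cn n) :
    X q = (proj10 ρ X q, 0) + (0, proj01 ρ X q) + theta ρ q (X q) • reeb ρ q := by
  ext j <;> simp [proj10, proj01]

namespace IsNondegenerateAt

variable (h : IsNondegenerateAt ρ q)

include h

theorem eventually_normalNormSq_ne_zero : ∀ᶠ z in 𝓝 q, normalNormSq ρ z ≠ 0 :=
  (contDiffAt_dotProduct (contDiffAt_rhoD h.contDiffAt) h.contDiffAt_normalVec).continuousAt
    |>.eventually_ne h.normalNormSq_ne_zero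

theorem differentiableAt_proj01 {X : CField n} (hX : DifferentiableAt ℝ X q) :
    DifferentiableAt ℝ (proj01 ρ X) q := by
  have hθ : DifferentiableAt ℝ (fun z => theta ρ z (X z)) q :=
    (differentiableAt_dotProduct ((contDiffAt_rhoDbar h.contDiffAt).differentiableAt (by simp))
      hX.snd).const_mul I
  exact hX.snd.sub (hθ.smul (h.contDiffAt_reeb.differentiableAt (by simp)).snd)

theorem sharp_vecMul_leviMat (φ : Cn n) : sharp ρ q φ ᵥ* leviMat ρ q = φ := by
  rw [sharp, vecMul_vecMul, nonsing_inv_mul _ h.det_leviMat_ne_zero.isUnit, vecMul_one]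

theorem sharp_leviMat_vecMul (Y : Cn n) : sharp ρ q (Y ᵥ* leviMat ρ q) = Y := by
  rw [sharp, vecMul_vecMul, mul_nonsing_inv _ h.det_leviMat_ne_zero.isUnit, vecMul_one]

theorem levi_normalVec (W : Cn n) : levi ρ q (normalVec ρ q) W = star (rhoD ρ q ⬝ᵥ W) := by
  rw [levi_eq, normalVec, h.sharp_vecMul_leviMat, rhoDbar_dotProduct_star]

theorem tangentPart_normalVec : tangentPart ρ q (normalVec ρ q) = 0 := by
  rw [tangentPart_apply, ← normalNormSq, div_self h.normalNormSq_ne_zero, one_smul, sub_self]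

theorem tangentPart_reeb10 : tangentPart ρ q (reeb10 ρ q) = 0 := by
  rw [reeb10, map_smul, h.tangentPart_normalVec, smul_zero]

theorem tangentPart_proj10 (X : CField n) :
    tangentPart ρ q (proj10 ρ X q) = tangentPart ρ q (X q).1 := by
  rw [proj10, map_sub, map_smul, reeb, h.tangentPart_reeb10, smul_zero, sub_zero]

theorem tangentPart_tangentPart (V : Cn n) :
    tangentPart ρ q (tangentPart ρ q V) = tangentPart ρ q V := by
  rw [tangentPart_apply _ _ V, map_sub, map_smul, h.tangentPart_normalVec, smul_zero, sub_zero,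
    tangentPart_apply]

theorem rhoD_dotProduct_tangentPart (V : Cn n) : rhoD ρ q ⬝ᵥ tangentPart ρ q V = 0 := by
  rw [tangentPart_apply, dotProduct_sub, dotProduct_smul, smul_eq_mul, ← normalNormSq,
    div_mul_cancel₀ _ h.normalNormSq_ne_zero, sub_self]

theorem levi_tangentPart {W : Cn n} (hW : rhoD ρ q ⬝ᵥ W = 0) (V : Cn n) :
    levi ρ q (tangentPart ρ q V) W = levi ρ q V W := by
  rw [tangentPart_apply, levi_sub_left, levi_smul_left, h.levi_normalVec, hW, star_zero, mul_zero,
    sub_zero]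

end IsNondegenerateAt

end LeviForm

section Connection

variable {n : ℕ} {ρ : Cn n → ℝ} {q : Cn n}

/-- The nondegenerate points of `{ρ = 0}` at which all first derivatives of the complex Hessian
`(ρ_{jk̄})` vanish. -/
structure HasStationaryHessianAt (ρ : Cn n → ℝ) (q : Cn n) : Prop
    extends IsNondegenerateAt ρ q where
  fderiv_leviMat_eq_zero : ∀ j k, fderiv ℝ (fun z => leviMat ρ z j k) q = 0

namespace HasStationaryHessianAt

variable (h : HasStationaryHessianAt ρ q) {X : CField n} {Y : Cn n → Cn n}

include h

theorem complexDeriv_vecMul_leviMat (hY : DifferentiableAt ℝ Y q) (w : Cn n × Cn n) :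
    complexDeriv (fun z => Y z ᵥ* leviMat ρ z) q w = complexDeriv Y q w ᵥ* leviMat ρ q := by
  have hL (k : Fin (n + 1)) : DifferentiableAt ℝ (fun z j => leviMat ρ z j k) q :=
    differentiableAt_pi.2 fun j => (contDiffAt_leviMat h.contDiffAt j k).differentiableAt (by simp)
  have hYL := differentiableAt_vecMul_leviMat h.contDiffAt hY
  have hzero (k : Fin (n + 1)) : complexDeriv (fun z j => leviMat ρ z j k) q w = 0 := by
    ext j
    rw [complexDeriv_apply_apply (hL k),
      complexDeriv_of_fderiv_eq_zero (h.fderiv_leviMat_eq_zero j k), Pi.zero_apply]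
  ext k
  rw [complexDeriv_apply_apply hYL]
  refine (complexDeriv_dotProduct hY (hL k) w).trans ?_
  rw [hzero, dotProduct_zero, add_zero, vecMul]

theorem nabla10_eq {X : Cn n → Cn n} (hY : DifferentiableAt ℝ Y q) :
    nabla10 ρ X Y q = tangentPart ρ q (complexDeriv Y q (X q, 0)) := by
  have hYL := differentiableAt_vecMul_leviMat h.contDiffAt hY
  have hsharp : sharp ρ q (fun k => lieD (hol X) (fun z => ∑ j, leviMat ρ z j k * Y z j) q) =
      complexDeriv Y q (X q, 0) := by
    rw [← h.sharp_leviMat_vecMul (complexDeriv Y q (X q, 0)), ← h.complexDeriv_vecMul_leviMat hY]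
    congr 1
    ext k
    rw [lieD_eq_complexDeriv, complexDeriv_apply_apply hYL]
    simp only [vecMul, dotProduct, mul_comm, hol]
  rw [nabla10, hsharp, tangentPart_apply, normalNormSq]

theorem complexDeriv_normalVec_vecMul (w : Cn n × Cn n) :
    complexDeriv (normalVec ρ) q w ᵥ* leviMat ρ q = complexDeriv (rhoDbar ρ) q w := by
  have hdet : ∀ᶠ z in 𝓝 q, (leviMat ρ z).det ≠ 0 :=
    (contDiffAt_matrix_det (contDiffAt_leviMat h.contDiffAt)).continuousAt.eventually_ne
      h.det_leviMat_ne_zero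
  have hξ : (fun z => normalVec ρ z ᵥ* leviMat ρ z) =ᶠ[𝓝 q] rhoDbar ρ := by
    filter_upwards [hdet] with z hz
    rw [normalVec, sharp, vecMul_vecMul, nonsing_inv_mul _ hz.isUnit, vecMul_one]
  rw [← h.complexDeriv_vecMul_leviMat (h.contDiffAt_normalVec.differentiableAt (by simp)),
    complexDeriv_congr hξ]

theorem complexDeriv_normalVec_fst (Y : Cn n) : complexDeriv (normalVec ρ) q (Y, 0) = Y := by
  rw [← h.sharp_leviMat_vecMul (complexDeriv _ q _), h.complexDeriv_normalVec_vecMul,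
    complexDeriv_rhoDbar_fst h.contDiffAt, h.sharp_leviMat_vecMul]

theorem tangentPart_complexDeriv_reeb10 {Y : Cn n} (hY : rhoD ρ q ⬝ᵥ Y = 0) :
    tangentPart ρ q (complexDeriv (reeb10 ρ) q (Y, 0)) = (I / normalNormSq ρ q) • Y := by
  have hdiff : DifferentiableAt ℝ (fun z => I / normalNormSq ρ z) q :=
    (h.contDiffAt_div_normalNormSq contDiffAt_const).differentiableAt (by simp)
  have hreeb : complexDeriv (reeb10 ρ) q (Y, 0) = _ :=
    complexDeriv_smul hdiff (h.contDiffAt_normalVec.differentiableAt (by simp)) (Y, 0)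
  rw [hreeb, h.complexDeriv_normalVec_fst, map_add, map_smul, map_smul, h.tangentPart_normalVec,
    smul_zero, zero_add, tangentPart_eq_self hY]

theorem rhoD_dotProduct_nabla (hX : DifferentiableAt ℝ X q) (hY : DifferentiableAt ℝ Y q)
    (hYρ : ∀ᶠ z in 𝓝 q, ρ z = 0 → rhoD ρ z ⬝ᵥ Y z = 0) : rhoD ρ q ⬝ᵥ nabla ρ X Y q = 0 := by
  have hν := h.normalNormSq_ne_zero
  have hproj01 := h.differentiableAt_proj01 hX
  have hYtangent : ∀ᶠ z in 𝓝 q,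
      ρ z = 0 → complexDeriv (fun z => (ρ z : ℂ)) z (hol Y z) = 0 :=
    hYρ.mono fun z hz hρz => by rw [complexDeriv_ofReal, hol, dotProduct_zero, hz hρz, add_zero]
  have hbracket {V : CField n} (hV : DifferentiableAt ℝ V q)
      (hVρ : ∀ z, normalNormSq ρ z ≠ 0 → complexDeriv (fun z => (ρ z : ℂ)) z (V z) = 0) :
      rhoD ρ q ⬝ᵥ proj10 ρ (bracket V (hol Y)) q = 0 := by
    rw [rhoD_dotProduct_proj10 hν]
    exact complexDeriv_ofReal_bracket_eq_zero h.contDiffAt h.fderiv_ne_zero h.eq_zero hV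
      (differentiableAt_hol hY)
      (h.eventually_normalNormSq_ne_zero.mono fun z hz _ => hVρ z hz) hYtangent
  have hantihol := hbracket (V := antihol (proj01 ρ X))
    (differentiableAt_antihol hproj01) fun z hz => by
      rw [complexDeriv_ofReal, antihol, dotProduct_zero, rhoDbar_dotProduct_proj01 hz, add_zero]
  have hreeb := hbracket (h.contDiffAt_reeb.differentiableAt (by simp)) fun z hz =>
    complexDeriv_ofReal_reeb hz
  rw [nabla, dotProduct_add, dotProduct_add, dotProduct_smul, h.nabla10_eq hY,
    h.rhoD_dotProduct_tangentPart, hantihol, hreeb, smul_zero, add_zero, add_zero]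

theorem nabla_eq (hX : DifferentiableAt ℝ X q) (hY : DifferentiableAt ℝ Y q)
    (hYρ : ∀ᶠ z in 𝓝 q, ρ z = 0 → rhoD ρ z ⬝ᵥ Y z = 0) :
    nabla ρ X Y q = tangentPart ρ q (complexDeriv Y q (X q)) -
      (theta ρ q (X q) * (I / normalNormSq ρ q)) • Y q := by
  have hbracket {V : CField n} (hV : DifferentiableAt ℝ V q) :
      tangentPart ρ q (proj10 ρ (bracket V (hol Y)) q) =
        tangentPart ρ q (complexDeriv Y q (V q)) -
          tangentPart ρ q (complexDeriv V q (Y q, 0)).1 := by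
    rw [h.tangentPart_proj10, bracket_eq hV (differentiableAt_hol hY),
      complexDeriv_hol hY, Prod.fst_sub, map_sub, hol]
  have hproj01 := h.differentiableAt_proj01 hX
  have hantihol := hbracket (V := antihol (proj01 ρ X)) (differentiableAt_antihol hproj01)
  have hreeb := hbracket (h.contDiffAt_reeb.differentiableAt (by simp))
  have hreeb10 : DifferentiableAt ℝ (reeb10 ρ) q :=
    h.contDiffAt_reeb10.differentiableAt (by simp)
  have hreeb' : complexDeriv (reeb ρ) q (Y q, 0) = _ :=
    complexDeriv_prodMk hreeb10 hreeb10.star _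
  rw [complexDeriv_antihol hproj01, map_zero, sub_zero] at hantihol
  rw [hreeb', h.tangentPart_complexDeriv_reeb10 (hYρ.self_of_nhds h.eq_zero)] at hreeb
  rw [← tangentPart_eq_self (h.rhoD_dotProduct_nabla hX hY hYρ), nabla, map_add, map_add, map_smul,
    h.nabla10_eq hY, h.tangentPart_tangentPart, hantihol, hreeb]
  have hX_eq := congr_arg (complexDeriv Y q) (eq_proj10_add_proj01_add_reeb ρ X q)
  rw [hX_eq]
  simp only [map_add, map_smul, antihol]
  module

end HasStationaryHessianAt

end Connection

section Curvature

variable {n : ℕ} {ρ : Cn n → ℝ}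

/-- The bilinear form `∑ ρ_{jk} Z_j W_k`. -/
noncomputable def hessForm (ρ : Cn n → ℝ) (q Z W : Cn n) : ℂ :=
  Z ᵥ* rhoDD ρ q ⬝ᵥ W

/-- `X` is smooth at `p`, and a section of `T^{1,0} ⊕ T^{0,1}` along `{ρ = 0}` near `p`. -/
structure IsHorizontalAt (ρ : Cn n → ℝ) (X : CField n) (p : Cn n) : Prop where
  contDiffAt : ContDiffAt ℝ ∞ X p
  fst_mem : ∀ᶠ z in 𝓝 p, ρ z = 0 → rhoD ρ z ⬝ᵥ (X z).1 = 0
  snd_mem : ∀ᶠ z in 𝓝 p, ρ z = 0 → rhoDbar ρ z ⬝ᵥ (X z).2 = 0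

variable {p : Cn n}

theorem isHorizontalAt_hol {Z : Cn n → Cn n} (hZ : IsSectionAt ρ Z p) :
    IsHorizontalAt ρ (hol Z) p where
  contDiffAt := contDiffAt_hol hZ.1
  fst_mem := hZ.2
  snd_mem := .of_forall fun _ _ => dotProduct_zero _

theorem isHorizontalAt_conjField {Z : Cn n → Cn n} (hZ : IsSectionAt ρ Z p) :
    IsHorizontalAt ρ (conjField Z) p where
  contDiffAt := contDiffAt_antihol (contDiffAt_star hZ.1)
  fst_mem := .of_forall fun _ _ => dotProduct_zero _
  snd_mem := hZ.2.mono fun z hz hρz =>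
    (rhoDbar_dotProduct_star ρ z (Z z)).trans (by rw [hz hρz, star_zero])

theorem eventually_differentiableAt {E F : Type*} [NormedAddCommGroup E] [NormedSpace ℝ E]
    [NormedAddCommGroup F] [NormedSpace ℝ F] {f : E → F} {x : E} (hf : ContDiffAt ℝ ∞ f x) :
    ∀ᶠ y in 𝓝 x, DifferentiableAt ℝ f y :=
  ((hf.of_le (m := 1) ENat.LEInfty.out).eventually (by simp)).mono fun _ hy =>
    hy.differentiableAt one_ne_zero

namespace HasStationaryHessianAt

variable {q : Cn n} (h : HasStationaryHessianAt ρ q) {X : CField n} {Y : Cn n → Cn n}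

include h

theorem nabla_eq_of_horizontal (hX : DifferentiableAt ℝ X q) (hY : DifferentiableAt ℝ Y q)
    (hYρ : ∀ᶠ z in 𝓝 q, ρ z = 0 → rhoD ρ z ⬝ᵥ Y z = 0) (hX₁ : rhoD ρ q ⬝ᵥ (X q).1 = 0)
    (hX₂ : rhoDbar ρ q ⬝ᵥ (X q).2 = 0) :
    nabla ρ X Y q = complexDeriv Y q (X q) +
      (complexDeriv (rhoD ρ) q (X q) ⬝ᵥ Y q / normalNormSq ρ q) • normalVec ρ q := by
  have hrhoD : DifferentiableAt ℝ (rhoD ρ) q :=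
    (contDiffAt_rhoD h.contDiffAt).differentiableAt (by simp)
  have hθ : theta ρ q (X q) = 0 := by rw [theta, ← dotProduct, hX₂, mul_zero]
  have hderiv : complexDeriv (fun z => rhoD ρ z ⬝ᵥ Y z) q (X q) = 0 :=
    complexDeriv_eq_zero_of_eqOn_level h.contDiffAt h.fderiv_ne_zero h.eq_zero
      (differentiableAt_dotProduct hrhoD hY) hYρ
      (by rw [complexDeriv_ofReal, hX₁, hX₂, add_zero])
  rw [complexDeriv_dotProduct hrhoD hY] at hderiv
  rw [h.nabla_eq hX hY hYρ, hθ, zero_mul, zero_smul, sub_zero, tangentPart_apply,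
    eq_neg_of_add_eq_zero_right hderiv]
  module

theorem theta_bracket {C D : Cn n → Cn n} (hC : DifferentiableAt ℝ C q)
    (hD : DifferentiableAt ℝ D q) (hCρ : rhoD ρ q ⬝ᵥ C q = 0)
    (hDρ : ∀ᶠ z in 𝓝 q, ρ z = 0 → rhoD ρ z ⬝ᵥ D z = 0) :
    theta ρ q (bracket (hol C) (conjField D) q) = -I * levi ρ q (C q) (D q) := by
  have hrhoDbar : DifferentiableAt ℝ (rhoDbar ρ) q :=
    (contDiffAt_rhoDbar h.contDiffAt).differentiableAt (by simp)
  have hDstar : DifferentiableAt ℝ (fun z => star (D z)) q := hD.star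
  have hsnd : (bracket (hol C) (conjField D) q).2 =
      complexDeriv (fun z => star (D z)) q (C q, 0) := by
    rw [conjField, bracket_eq (differentiableAt_hol hC) (differentiableAt_antihol hDstar),
      complexDeriv_hol hC, complexDeriv_antihol hDstar, Prod.snd_sub, sub_zero, hol]
  have hderiv : complexDeriv (fun z => rhoDbar ρ z ⬝ᵥ star (D z)) q (C q, 0) = 0 :=
    complexDeriv_eq_zero_of_eqOn_level h.contDiffAt h.fderiv_ne_zero h.eq_zero
      (differentiableAt_dotProduct hrhoDbar hDstar)
      (hDρ.mono fun z hz hρz => by rw [rhoDbar_dotProduct_star, hz hρz, star_zero])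
      (by rw [complexDeriv_ofReal, hCρ, dotProduct_zero, add_zero])
  rw [complexDeriv_dotProduct hrhoDbar hDstar, complexDeriv_rhoDbar_fst h.contDiffAt,
    ← levi_eq] at hderiv
  rw [theta, ← dotProduct, hsnd, eq_neg_of_add_eq_zero_right hderiv]
  ring

end HasStationaryHessianAt

theorem complexDeriv_nabla (hρ : ∀ᶠ z in 𝓝 p, ρ z = 0 → HasStationaryHessianAt ρ z)
    (hp : ρ p = 0) {X X' : CField n} {A : Cn n → Cn n} (hX : IsHorizontalAt ρ X p)
    (hX' : IsHorizontalAt ρ X' p) (hA : IsSectionAt ρ A p) :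
    ∃ c : ℂ, complexDeriv (nabla ρ X' A) p (X p) =
      complexDeriv (fun z => complexDeriv A z (X' z)) p (X p) + (c • normalVec ρ p +
        (complexDeriv (rhoD ρ) p (X' p) ⬝ᵥ A p / normalNormSq ρ p) •
          complexDeriv (normalVec ρ) p (X p)) := by
  have h := hρ.self_of_nhds hp
  let s (z : Cn n) : ℂ := complexDeriv (rhoD ρ) z (X' z) ⬝ᵥ A z / normalNormSq ρ z
  have hs : DifferentiableAt ℝ s p :=
    (h.contDiffAt_div_normalNormSq (contDiffAt_dotProduct (contDiffAt_complexDeriv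
      (contDiffAt_rhoD h.contDiffAt) hX'.contDiffAt) hA.1)).differentiableAt (by simp)
  have hξ : DifferentiableAt ℝ (normalVec ρ) p := h.contDiffAt_normalVec.differentiableAt (by simp)
  have hDA : DifferentiableAt ℝ (fun z => complexDeriv A z (X' z)) p :=
    (contDiffAt_complexDeriv hA.1 hX'.contDiffAt).differentiableAt (by simp)
  have hnabla : ∀ᶠ z in 𝓝 p, ρ z = 0 →
      nabla ρ X' A z = complexDeriv A z (X' z) + s z • normalVec ρ z := by
    filter_upwards [hρ, eventually_differentiableAt hX'.contDiffAt,
      eventually_differentiableAt hA.1, hA.2.eventually_nhds, hX'.fst_mem, hX'.snd_mem]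
      with z hz hX'z hAz hAρ hX'₁ hX'₂ hρz
    exact (hz hρz).nabla_eq_of_horizontal hX'z hAz hAρ (hX'₁ hρz) (hX'₂ hρz)
  have hderiv : complexDeriv (nabla ρ X' A) p (X p) = _ :=
    complexDeriv_congr_of_eqOn_level h.contDiffAt h.fderiv_ne_zero hp
      ((h.contDiffAt_nabla hX'.contDiffAt hA.1).differentiableAt (by simp))
      (hDA.fun_add (hs.fun_smul hξ)) hnabla
      (by rw [complexDeriv_ofReal, hX.fst_mem.self_of_nhds hp, hX.snd_mem.self_of_nhds hp,
        add_zero])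
  exact ⟨complexDeriv s p (X p), by
    rw [hderiv, complexDeriv_add hDA (hs.fun_smul hξ), complexDeriv_smul hs hξ]⟩

theorem levi_nabla_nabla (hρ : ∀ᶠ z in 𝓝 p, ρ z = 0 → HasStationaryHessianAt ρ z) (hp : ρ p = 0)
    {X X' : CField n} {A : Cn n → Cn n} {W : Cn n} (hX : IsHorizontalAt ρ X p)
    (hX' : IsHorizontalAt ρ X' p) (hA : IsSectionAt ρ A p) (hW : rhoD ρ p ⬝ᵥ W = 0) :
    levi ρ p (nabla ρ X (nabla ρ X' A) p) W =
      levi ρ p (complexDeriv (fun z => complexDeriv A z (X' z)) p (X p)) W +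
        complexDeriv (rhoD ρ) p (X' p) ⬝ᵥ A p / normalNormSq ρ p *
          levi ρ p (complexDeriv (normalVec ρ) p (X p)) W := by
  have h := hρ.self_of_nhds hp
  have hθ : theta ρ p (X p) = 0 := by
    rw [theta, ← dotProduct, hX.snd_mem.self_of_nhds hp, mul_zero]
  have hnabla : DifferentiableAt ℝ (nabla ρ X' A) p :=
    (h.contDiffAt_nabla hX'.contDiffAt hA.1).differentiableAt (by simp)
  have hnabla_tangent : ∀ᶠ z in 𝓝 p, ρ z = 0 → rhoD ρ z ⬝ᵥ nabla ρ X' A z = 0 := by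
    filter_upwards [hρ, eventually_differentiableAt hX'.contDiffAt,
      eventually_differentiableAt hA.1, hA.2.eventually_nhds] with z hz hX'z hAz hAρ hρz
    exact (hz hρz).rhoD_dotProduct_nabla hX'z hAz hAρ
  obtain ⟨c, hc⟩ := complexDeriv_nabla hρ hp hX hX' hA
  rw [h.nabla_eq (hX.contDiffAt.differentiableAt (by simp)) hnabla hnabla_tangent, hθ, zero_mul,
    zero_smul, sub_zero, h.levi_tangentPart hW, hc, levi_add_left, levi_add_left, levi_smul_left,
    levi_smul_left, h.levi_normalVec, hW, star_zero, mul_zero, zero_add]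

theorem curvTensor_eq (hρ : ∀ᶠ z in 𝓝 p, ρ z = 0 → HasStationaryHessianAt ρ z) (hp : ρ p = 0)
    {A B C D : Cn n → Cn n} (hA : IsSectionAt ρ A p) (hB : IsSectionAt ρ B p)
    (hC : IsSectionAt ρ C p) (hD : IsSectionAt ρ D p) :
    curvTensor ρ A B C D p =
      (levi ρ p (A p) (D p) * levi ρ p (C p) (B p) + levi ρ p (C p) (D p) * levi ρ p (A p) (B p) -
        hessForm ρ p (C p) (A p) * star (hessForm ρ p (D p) (B p))) / normalNormSq ρ p := by
  have h := hρ.self_of_nhds hp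
  have hB₀ := hB.2.self_of_nhds hp
  have hZ := isHorizontalAt_hol hC
  have hW := isHorizontalAt_conjField hD
  have hbracket : nabla ρ (bracket (hol C) (conjField D)) A p = _ :=
    h.nabla_eq ((contDiffAt_bracket hZ.contDiffAt hW.contDiffAt).differentiableAt (by simp))
      (hA.1.differentiableAt (by simp)) hA.2
  have hcomm : complexDeriv A p (bracket (hol C) (conjField D) p) = _ :=
    complexDeriv_bracket (hA.1.of_le ENat.LEInfty.out) (hZ.contDiffAt.differentiableAt (by simp))
      (hW.contDiffAt.differentiableAt (by simp))
  have hrhoD_C : complexDeriv (rhoD ρ) p (hol C p) ⬝ᵥ A p = hessForm ρ p (C p) (A p) := by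
    rw [hol, complexDeriv_rhoD_fst h.contDiffAt, hessForm]
  have hrhoD_D : complexDeriv (rhoD ρ) p (conjField D p) ⬝ᵥ A p = levi ρ p (A p) (D p) := by
    rw [conjField, antihol, complexDeriv_rhoD_snd h.contDiffAt, ← star_levi h.contDiffAt, levi_eq,
      ← star_dotProduct_star, star_star, dotProduct_comm]
  have hξ_C : levi ρ p (complexDeriv (normalVec ρ) p (hol C p)) (B p) = levi ρ p (C p) (B p) := by
    rw [hol, h.complexDeriv_normalVec_fst]
  have hξ_D : levi ρ p (complexDeriv (normalVec ρ) p (conjField D p)) (B p) =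
      star (hessForm ρ p (D p) (B p)) := by
    rw [levi_eq, h.complexDeriv_normalVec_vecMul, conjField, antihol,
      complexDeriv_rhoDbar_snd h.contDiffAt, star_dotProduct_star, dotProduct_comm, hessForm]
  rw [curvTensor, curv, levi_sub_left, levi_sub_left, levi_nabla_nabla hρ hp hZ hW hA hB₀,
    levi_nabla_nabla hρ hp hW hZ hA hB₀, hbracket, levi_sub_left, h.levi_tangentPart hB₀, hcomm,
    levi_sub_left, levi_smul_left, hrhoD_C, hrhoD_D, hξ_C, hξ_D, h.theta_bracket
      (hC.1.differentiableAt (by simp)) (hD.1.differentiableAt (by simp)) (hC.2.self_of_nhds hp)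
      hD.2]
  linear_combination (-levi ρ p (C p) (D p) * levi ρ p (A p) (B p) / normalNormSq ρ p) * I_mul_I

end Curvature

section Trace

variable {κ : Type*} [Fintype κ]

open scoped MatrixOrder in
theorem trace_mul_nonneg {A B : Matrix κ κ ℂ} (hA : A.PosSemidef) (hB : B.PosSemidef) :
    0 ≤ (A * B).trace := by
  classical
  obtain ⟨C, rfl⟩ := CStarAlgebra.nonneg_iff_eq_star_mul_self.1 hA.nonneg
  rw [Matrix.mul_assoc, trace_mul_comm]
  exact (hB.mul_mul_conjTranspose_same C).trace_nonneg

theorem trace_mul_mul_mul {R : Type*} [Semiring R] (A B C D : Matrix κ κ R) :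
    (A * B * C * D).trace = ∑ i, ∑ j, ∑ k, ∑ l, A i j * B j k * C k l * D l i := by
  simp only [trace, diag_apply, mul_apply, Finset.mul_sum, _root_.mul_assoc]

variable [DecidableEq κ] {h H : Matrix κ κ ℂ}

theorem posSemidef_sub_of_two_mul_re_le (hh : h.PosDef)
    (hH : ∀ x y, 2 * (x ᵥ* H ⬝ᵥ y).re ≤ (x ᵥ* h ⬝ᵥ star x).re + (y ᵥ* h ⬝ᵥ star y).re) :
    (h - H * h⁻¹ᵀ * Hᴴ).PosSemidef := by
  have hK : (H * h⁻¹ᵀ * Hᴴ).PosSemidef := hh.inv.transpose.posSemidef.mul_mul_conjTranspose_same H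
  refine .of_dotProduct_mulVec_nonneg (hh.1.sub hK.1) fun x => ?_
  obtain ⟨w, hw⟩ : ∃ w, star x ᵥ* H = w := ⟨_, rfl⟩
  -- The maximizer of `2 Re (w ⬝ᵥ y) - y ᵥ* h ⬝ᵥ star y`.
  obtain ⟨y, hy⟩ : ∃ y, star w ᵥ* h⁻¹ = y := ⟨_, rfl⟩
  have hwy : w ⬝ᵥ y = star x ⬝ᵥ (H * h⁻¹ᵀ * Hᴴ) *ᵥ x := by
    rw [dotProduct_mulVec, ← vecMul_vecMul, ← vecMul_vecMul, hw, ← dotProduct_mulVec,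
      ← dotProduct_mulVec, mulVec_transpose, ← star_star (Hᴴ *ᵥ x), star_mulVec,
      conjTranspose_conjTranspose, hw, hy]
  have hyh : y ᵥ* h ⬝ᵥ star y = w ⬝ᵥ y := by
    rw [← hy, vecMul_vecMul, nonsing_inv_mul _ hh.det_pos.ne'.isUnit, vecMul_one, star_vecMul,
      star_star, hh.inv.1.eq, dotProduct_mulVec, dotProduct_comm]
  have hle := hH (star x) y
  rw [hyh, hw, star_star, ← dotProduct_mulVec, hwy] at hle
  refine Complex.nonneg_iff.2 ⟨?_, ((hh.1.sub hK.1).im_star_dotProduct_mulVec_self x).symm⟩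
  rw [sub_mulVec, dotProduct_sub, sub_re]
  linarith

theorem trace_inv_transpose_mul_le (hh : h.PosDef)
    (hH : ∀ x y, 2 * (x ᵥ* H ⬝ᵥ y).re ≤ (x ᵥ* h ⬝ᵥ star x).re + (y ᵥ* h ⬝ᵥ star y).re) :
    (h⁻¹ᵀ * Hᴴ * h⁻¹ * H).trace ≤ Fintype.card κ := by
  have hnonneg := trace_mul_nonneg hh.inv.posSemidef (posSemidef_sub_of_two_mul_re_le hh hH)
  rwa [Matrix.mul_sub, trace_sub, nonsing_inv_mul _ hh.det_pos.ne'.isUnit, trace_one, sub_nonneg,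
    Matrix.mul_assoc H, ← Matrix.mul_assoc, trace_mul_comm, ← Matrix.mul_assoc] at hnonneg

theorem sum_inv_mul_inv_mul_eq {g : Matrix κ κ ℂ} (hg : g * h = 1) (ν : ℂ) :
    ∑ α, ∑ β, ∑ γ, ∑ σ, g β α * g σ γ *
      ((h α σ * h γ β + h γ σ * h α β - H γ α * star (H σ β)) / ν) =
      (Fintype.card κ + Fintype.card κ ^ 2 - (gᵀ * Hᴴ * g * H).trace) / ν := by
  have hcross : ∑ α, ∑ β, ∑ γ, ∑ σ, g β α * g σ γ * (h α σ * h γ β) = Fintype.card κ := by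
    have hghgh : g * h * g * h = 1 := by rw [Matrix.mul_assoc, hg, Matrix.one_mul]
    rw [← trace_one, ← hghgh, trace_mul_mul_mul, Finset.sum_comm]
    refine Finset.sum_congr rfl fun β _ => Finset.sum_congr rfl fun α _ => ?_
    rw [Finset.sum_comm]
    exact Finset.sum_congr rfl fun σ _ => Finset.sum_congr rfl fun γ _ => by ring
  have htrace : ∑ α, ∑ β, g β α * h α β = Fintype.card κ := by
    rw [Finset.sum_comm, ← trace_one, ← hg]
    rfl
  have hdiag : ∑ α, ∑ β, ∑ γ, ∑ σ, g β α * g σ γ * (h γ σ * h α β) =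
      (Fintype.card κ : ℂ) ^ 2 := by
    simp only [sq, ← htrace, Finset.sum_mul, Finset.mul_sum]
    exact Finset.sum_congr rfl fun α _ => Finset.sum_congr rfl fun β _ =>
      Finset.sum_congr rfl fun γ _ => Finset.sum_congr rfl fun σ _ => by ring
  have hhess : ∑ α, ∑ β, ∑ γ, ∑ σ, g β α * g σ γ * (H γ α * star (H σ β)) =
      (gᵀ * Hᴴ * g * H).trace := by
    rw [trace_mul_mul_mul]
    refine Finset.sum_congr rfl fun α _ => Finset.sum_congr rfl fun β _ => ?_
    rw [Finset.sum_comm]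
    exact Finset.sum_congr rfl fun σ _ => Finset.sum_congr rfl fun γ _ => by
      rw [transpose_apply, conjTranspose_apply]; ring
  rw [← hhess, ← hdiag]
  nth_rw 1 [← hcross]
  simp only [← Finset.sum_add_distrib, ← Finset.sum_sub_distrib, Finset.sum_div]
  refine Finset.sum_congr rfl fun α _ => Finset.sum_congr rfl fun β _ =>
    Finset.sum_congr rfl fun γ _ => Finset.sum_congr rfl fun σ _ => by ring

end Trace

section Convexity

variable {n : ℕ} {ρ : Cn n → ℝ} {q : Cn n}

theorem hess_eq (ρ : Cn n → ℝ) (q η : Cn n) :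
    hess ρ q η = (hessForm ρ q η η).re + (levi ρ q η η).re := by
  rw [hess, hessForm, levi_eq]
  congr 2 <;> rw [Finset.sum_comm] <;>
    simp only [dotProduct, vecMul, Finset.sum_mul, Pi.star_apply, mul_comm (η _)]

theorem hessForm_comm (hρ : ContDiffAt ℝ ∞ ρ q) (Z W : Cn n) :
    hessForm ρ q Z W = hessForm ρ q W Z := by
  have hsymm : (rhoDD ρ q)ᵀ = rhoDD ρ q := Matrix.ext fun j k => rhoDD_apply_comm hρ k j
  rw [hessForm, ← dotProduct_mulVec, ← vecMul_transpose, hsymm, dotProduct_comm, hessForm]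

theorem hessForm_sub_add_hessForm_I_smul_add (hρ : ContDiffAt ℝ ∞ ρ q) (Z W : Cn n) :
    hessForm ρ q (Z - W) (Z - W) + hessForm ρ q (I • (Z + W)) (I • (Z + W)) =
      -4 * hessForm ρ q Z W := by
  have hcomm := hessForm_comm hρ Z W
  simp only [hessForm, sub_vecMul, sub_dotProduct, dotProduct_sub, smul_vecMul, smul_dotProduct,
    dotProduct_smul, add_vecMul, add_dotProduct, dotProduct_add, smul_eq_mul] at hcomm ⊢
  linear_combination (Z ᵥ* rhoDD ρ q ⬝ᵥ Z + Z ᵥ* rhoDD ρ q ⬝ᵥ W + W ᵥ* rhoDD ρ q ⬝ᵥ Z +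
    W ᵥ* rhoDD ρ q ⬝ᵥ W) * I_mul_I + 2 * hcomm

theorem levi_sub_add_levi_I_smul_add (ρ : Cn n → ℝ) (q Z W : Cn n) :
    levi ρ q (Z - W) (Z - W) + levi ρ q (I • (Z + W)) (I • (Z + W)) =
      2 * (levi ρ q Z Z + levi ρ q W W) := by
  simp only [levi_eq, sub_vecMul, sub_dotProduct, dotProduct_sub, smul_vecMul, smul_dotProduct,
    dotProduct_smul, add_vecMul, add_dotProduct, dotProduct_add, star_smul, star_add, star_sub,
    smul_eq_mul, star_def, conj_I]
  linear_combination -(Z ᵥ* leviMat ρ q ⬝ᵥ star Z + Z ᵥ* leviMat ρ q ⬝ᵥ star W +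
    W ᵥ* leviMat ρ q ⬝ᵥ star Z + W ᵥ* leviMat ρ q ⬝ᵥ star W) * I_mul_I

theorem two_mul_re_hessForm_le (hρ : ContDiffAt ℝ ∞ ρ q)
    (hconv : ∀ η : Cn n, rhoD ρ q ⬝ᵥ η = 0 → 0 ≤ hess ρ q η) {Z W : Cn n}
    (hZ : rhoD ρ q ⬝ᵥ Z = 0) (hW : rhoD ρ q ⬝ᵥ W = 0) :
    2 * (hessForm ρ q Z W).re ≤ (levi ρ q Z Z).re + (levi ρ q W W).re := by
  have hsub := hconv (Z - W) (by rw [dotProduct_sub, hZ, hW, sub_zero])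
  have hadd := hconv (I • (Z + W))
    (by rw [dotProduct_smul, dotProduct_add, hZ, hW, add_zero, smul_zero])
  have hhess : (hessForm ρ q (Z - W) (Z - W)).re + (hessForm ρ q (I • (Z + W)) (I • (Z + W))).re =
      -4 * (hessForm ρ q Z W).re := by
    rw [← add_re, hessForm_sub_add_hessForm_I_smul_add hρ]
    norm_num
  have hlevi : (levi ρ q (Z - W) (Z - W)).re + (levi ρ q (I • (Z + W)) (I • (Z + W))).re =
      2 * ((levi ρ q Z Z).re + (levi ρ q W W).re) := by
    rw [← add_re, levi_sub_add_levi_I_smul_add]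
    norm_num
  rw [hess_eq] at hsub hadd
  linarith

theorem norm_hessForm_self_le (hρ : ContDiffAt ℝ ∞ ρ q)
    (hconv : ∀ η : Cn n, rhoD ρ q ⬝ᵥ η = 0 → 0 ≤ hess ρ q η) {Z : Cn n}
    (hZ : rhoD ρ q ⬝ᵥ Z = 0) : ‖hessForm ρ q Z Z‖ ≤ (levi ρ q Z Z).re := by
  obtain ⟨c, hc, hcH⟩ := exists_norm_eq_mul_self (hessForm ρ q Z Z)
  have hle := two_mul_re_hessForm_le hρ hconv hZ
    (show rhoD ρ q ⬝ᵥ (c • Z) = 0 by rw [dotProduct_smul, hZ, smul_zero])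
  have hhess : hessForm ρ q Z (c • Z) = ‖hessForm ρ q Z Z‖ := by
    rw [hcH, hessForm, dotProduct_smul, smul_eq_mul, hessForm]
  have hlevi : levi ρ q (c • Z) (c • Z) = levi ρ q Z Z := by
    rw [levi_smul_left, levi_eq, star_smul, dotProduct_smul, ← levi_eq, smul_eq_mul, ← mul_assoc,
      star_def, mul_conj, normSq_eq_norm_sq, hc, one_pow, ofReal_one, one_mul]
  rw [hhess, hlevi, ofReal_re] at hle
  linarith

end Convexity

section PosDef

variable {n : ℕ} {ρ : Cn n → ℝ} {q : Cn n}

theorem fderiv_eq_zero_of_rhoD_eq_zero (hρ : DifferentiableAt ℝ ρ q) (h : rhoD ρ q = 0) :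
    fderiv ℝ ρ q = 0 := by
  ext v
  have hv := complexDeriv_ofReal ρ q (v, star v)
  rw [complexDeriv_self_star, fderiv_ofReal_comp hρ, rhoDbar_dotProduct_star, h, zero_dotProduct,
    star_zero, add_zero] at hv
  exact ofReal_eq_zero.1 hv

theorem normalNormSq_pos (hρ : DifferentiableAt ℝ ρ q) (hd : fderiv ℝ ρ q ≠ 0)
    (hL : (leviMat ρ q).PosDef) : 0 < normalNormSq ρ q := by
  rw [normalNormSq, normalVec, sharp, rhoDbar_eq_star_rhoD, dotProduct_comm, ← dotProduct_mulVec]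
  exact hL.inv.dotProduct_mulVec_pos fun h => hd (fderiv_eq_zero_of_rhoD_eq_zero hρ h)

theorem levi_self_pos (hL : (leviMat ρ q).PosDef) {Z : Cn n} (hZ : Z ≠ 0) :
    0 < levi ρ q Z Z := by
  rw [levi_eq, ← dotProduct_mulVec]
  simpa only [star_star] using hL.dotProduct_mulVec_pos (star_ne_zero.2 hZ)

end PosDef

section CurvatureBounds

variable {n : ℕ} {ρ : Cn n → ℝ} {p : Cn n}

theorem half_inv_le_holSecCurv (hρ : ∀ᶠ z in 𝓝 p, ρ z = 0 → HasStationaryHessianAt ρ z)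
    (hp : ρ p = 0) (hL : (leviMat ρ p).PosDef)
    (hconv : ∀ η : Cn n, rhoD ρ p ⬝ᵥ η = 0 → 0 ≤ hess ρ p η) {Z : Cn n → Cn n}
    (hZ : IsSectionAt ρ Z p) (hZ₀ : Z p ≠ 0) :
    1 / 2 * (normalNormSq ρ p).re⁻¹ ≤ holSecCurv ρ Z p := by
  have h := hρ.self_of_nhds hp
  have hH := norm_hessForm_self_le h.contDiffAt hconv (hZ.2.self_of_nhds hp)
  obtain ⟨l, hl, hl_eq⟩ : ∃ l : ℝ, 0 < l ∧ (l : ℂ) = levi ρ p (Z p) (Z p) :=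
    RCLike.pos_iff_exists_ofReal.1 (levi_self_pos hL hZ₀)
  obtain ⟨ν, hν, hν_eq⟩ : ∃ ν : ℝ, 0 < ν ∧ (ν : ℂ) = normalNormSq ρ p :=
    RCLike.pos_iff_exists_ofReal.1 <|
    (normalNormSq_pos (h.contDiffAt.differentiableAt (by simp)) h.fderiv_ne_zero hL)
  rw [← hl_eq, ofReal_re] at hH
  have hcurv : (curvTensor ρ Z Z Z Z p).re = (2 * l ^ 2 - ‖hessForm ρ p (Z p) (Z p)‖ ^ 2) / ν := by
    rw [curvTensor_eq hρ hp hZ hZ hZ hZ, ← hl_eq, ← hν_eq, star_def, mul_conj, normSq_eq_norm_sq]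
    norm_cast
    ring
  have hsq : ‖hessForm ρ p (Z p) (Z p)‖ ^ 2 ≤ l ^ 2 := by gcongr
  rw [holSecCurv, hcurv, ← hl_eq, ← hν_eq, ofReal_re, ofReal_re, le_div_iff₀ (by positivity),
    mul_assoc, inv_mul_eq_div]
  gcongr
  linarith

variable {Z : Fin n → Cn n → Cn n}

theorem frameMat_eq (ρ : Cn n → ℝ) (Z : Fin n → Cn n → Cn n) (p : Cn n) :
    frameMat ρ Z p = of (fun α => Z α p) * leviMat ρ p * (of fun α => Z α p)ᴴ := by
  ext α β
  rw [frameMat, levi_eq]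
  rfl

theorem posDef_frameMat (hL : (leviMat ρ p).PosDef)
    (hZ : LinearIndependent ℂ fun α => Z α p) : (frameMat ρ Z p).PosDef := by
  rw [frameMat_eq]
  exact hL.mul_mul_conjTranspose_same (vecMul_injective_iff.2 hZ)

/-- The matrix `H_{γα} = ∑ ρ_{jk} (Z_γ)_j (Z_α)_k` of `hessForm` in the frame `Z`. -/
noncomputable def frameHess (ρ : Cn n → ℝ) (Z : Fin n → Cn n → Cn n) (p : Cn n) :
    Matrix (Fin n) (Fin n) ℂ :=
  fun γ α => hessForm ρ p (Z γ p) (Z α p)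

theorem frameHess_eq (ρ : Cn n → ℝ) (Z : Fin n → Cn n → Cn n) (p : Cn n) :
    frameHess ρ Z p = of (fun α => Z α p) * rhoDD ρ p * (of fun α => Z α p)ᵀ := by
  ext γ α
  rw [frameHess, hessForm]
  rfl

theorem two_mul_re_vecMul_frameHess_le (hρ : ContDiffAt ℝ ∞ ρ p)
    (hconv : ∀ η : Cn n, rhoD ρ p ⬝ᵥ η = 0 → 0 ≤ hess ρ p η)
    (hZ : ∀ α, rhoD ρ p ⬝ᵥ Z α p = 0) (x y : Fin n → ℂ) :
    2 * (x ᵥ* frameHess ρ Z p ⬝ᵥ y).re ≤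
      (x ᵥ* frameMat ρ Z p ⬝ᵥ star x).re + (y ᵥ* frameMat ρ Z p ⬝ᵥ star y).re := by
  let P : Matrix (Fin n) (Fin (n + 1)) ℂ := of fun α => Z α p
  have htangent (x : Fin n → ℂ) : rhoD ρ p ⬝ᵥ (x ᵥ* P) = 0 := by
    have hP : P *ᵥ rhoD ρ p = 0 := funext fun α => (dotProduct_comm _ _).trans (hZ α)
    rw [dotProduct_comm, ← dotProduct_mulVec, hP, dotProduct_zero]
  have hlevi (x : Fin n → ℂ) :
      levi ρ p (x ᵥ* P) (x ᵥ* P) = x ᵥ* frameMat ρ Z p ⬝ᵥ star x := by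
    rw [levi_eq, frameMat_eq, star_vecMul, ← vecMul_vecMul, ← vecMul_vecMul, dotProduct_mulVec]
  have hhess : hessForm ρ p (x ᵥ* P) (y ᵥ* P) = x ᵥ* frameHess ρ Z p ⬝ᵥ y := by
    rw [hessForm, frameHess_eq, ← vecMul_vecMul, ← vecMul_vecMul, ← dotProduct_mulVec _ Pᵀ,
      mulVec_transpose]
  rw [← hhess, ← hlevi, ← hlevi]
  exact two_mul_re_hessForm_le hρ hconv (htangent x) (htangent y)

theorem sq_mul_inv_le_scalarCurv (hρ : ∀ᶠ z in 𝓝 p, ρ z = 0 → HasStationaryHessianAt ρ z)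
    (hp : ρ p = 0) (hL : (leviMat ρ p).PosDef)
    (hconv : ∀ η : Cn n, rhoD ρ p ⬝ᵥ η = 0 → 0 ≤ hess ρ p η) (hZ : IsFrameAt ρ Z p) :
    n ^ 2 * (normalNormSq ρ p).re⁻¹ ≤ scalarCurv ρ Z p := by
  have h := hρ.self_of_nhds hp
  have hν := normalNormSq_pos (h.contDiffAt.differentiableAt (by simp)) h.fderiv_ne_zero hL
  have hmat := posDef_frameMat hL hZ.2
  let T := ((frameMat ρ Z p)⁻¹ᵀ * (frameHess ρ Z p)ᴴ * (frameMat ρ Z p)⁻¹ * frameHess ρ Z p).trace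
  have htrace : T ≤ n := by
    simpa only [Fintype.card_fin] using trace_inv_transpose_mul_le hmat
      (two_mul_re_vecMul_frameHess_le h.contDiffAt hconv fun α => (hZ.1 α).2.self_of_nhds hp)
  have hscalar : scalarCurv ρ Z p = ((n + n ^ 2 - T) / normalNormSq ρ p).re := by
    have hsum := sum_inv_mul_inv_mul_eq (H := frameHess ρ Z p)
      (nonsing_inv_mul _ hmat.det_pos.ne'.isUnit) (normalNormSq ρ p)
    rw [Fintype.card_fin] at hsum
    rw [scalarCurv, ← hsum]
    simp only [curvTensor_eq hρ hp (hZ.1 _) (hZ.1 _) (hZ.1 _) (hZ.1 _)]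
    rfl
  have hle : (n ^ 2 * (normalNormSq ρ p)⁻¹ : ℂ) ≤ (n + n ^ 2 - T) / normalNormSq ρ p := by
    rw [div_eq_mul_inv]
    refine mul_le_mul_of_nonneg_right ?_ (inv_nonneg.2 hν.le)
    linear_combination htrace
  obtain ⟨ν, -, hν_eq⟩ : ∃ ν : ℝ, 0 < ν ∧ (ν : ℂ) = normalNormSq ρ p :=
    RCLike.pos_iff_exists_ofReal.1 hν
  rw [hscalar]
  refine le_trans (le_of_eq ?_) (Complex.le_def.1 hle).1
  rw [← hν_eq, ofReal_re]
  norm_cast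

end CurvatureBounds

section ConstantHessian

variable {n : ℕ} {ρ : Cn n → ℝ} {a : Matrix (Fin (n + 1)) (Fin (n + 1)) ℂ} {q : Cn n}

theorem leviMat_eq_of_isLittleO (h₀ : ρ q = 0)
    (ha : ∀ j k, (fun z => leviMat ρ z j k - a j k) =o[𝓝 q] ρ) : leviMat ρ q = a := by
  ext j k
  have h := ((ha j k).def one_pos).self_of_nhds
  rw [h₀, norm_zero, mul_zero, norm_le_zero_iff] at h
  exact sub_eq_zero.1 h

theorem hasFDerivAt_leviMat_of_isLittleO (hρ : DifferentiableAt ℝ ρ q) (h₀ : ρ q = 0)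
    (ha : ∀ j k, (fun z => leviMat ρ z j k - a j k) =o[𝓝 q] ρ) (j k : Fin (n + 1)) :
    HasFDerivAt (fun z => leviMat ρ z j k) (0 : Cn n →L[ℝ] ℂ) q := by
  have hO : ρ =O[𝓝 q] fun z => z - q := by simpa [h₀] using hρ.isBigO_sub
  refine .of_isLittleO ?_
  simpa [leviMat_eq_of_isLittleO h₀ ha] using (ha j k).trans_isBigO hO

theorem normSqD_eq_re_normalNormSq (ha : leviMat ρ q = a) :
    normSqD a ρ q = (normalNormSq ρ q).re := by
  rw [normSqD, normalNormSq, normalVec, sharp, ha]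
  simp only [dotProduct, Matrix.vecMul, Finset.mul_sum]
  congr 1
  exact Finset.sum_congr rfl fun j _ => Finset.sum_congr rfl fun k _ => by ring

theorem normSqD_pos (hL : leviMat ρ q = a) (hρ : DifferentiableAt ℝ ρ q)
    (hd : fderiv ℝ ρ q ≠ 0) (ha : a.PosDef) : 0 < normSqD a ρ q := by
  rw [normSqD_eq_re_normalNormSq hL]
  exact (Complex.pos_iff.1 (normalNormSq_pos hρ hd (hL ▸ ha))).1

theorem hasStationaryHessianAt_of_isLittleO (hρ : ContDiffAt ℝ ∞ ρ q) (h₀ : ρ q = 0)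
    (hd : fderiv ℝ ρ q ≠ 0) (ha : a.PosDef)
    (hρa : ∀ j k, (fun z => leviMat ρ z j k - a j k) =o[𝓝 q] ρ) :
    HasStationaryHessianAt ρ q := by
  have hdiff : DifferentiableAt ℝ ρ q := hρ.differentiableAt (by simp)
  have hL : (leviMat ρ q).PosDef := leviMat_eq_of_isLittleO h₀ hρa ▸ ha
  exact {
    contDiffAt := hρ
    eq_zero := h₀
    det_leviMat_ne_zero := hL.det_pos.ne'
    normalNormSq_ne_zero := (normalNormSq_pos hdiff hd hL).ne'
    fderiv_leviMat_eq_zero j k := (hasFDerivAt_leviMat_of_isLittleO hdiff h₀ hρa j k).fderiv }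

end ConstantHessian

end Pseudohermitian

theorem corollary1p3_general {n : ℕ} {U : Set (Cn n)} {ρ : Cn n → ℝ}
    {a : Matrix (Fin (n + 1)) (Fin (n + 1)) ℂ} (hU : IsOpen U) (hρ : ContDiffOn ℝ ∞ ρ U)
    (hd : ∀ q ∈ zeroSet U ρ, fderiv ℝ ρ q ≠ 0) (ha : a.PosDef)
    (hρa : ∀ q ∈ zeroSet U ρ, ∀ j k, (fun z => leviMat ρ z j k - a j k) =o[𝓝 q] ρ) {p : Cn n}
    (hp : p ∈ zeroSet U ρ) (hconv : ∀ η : Cn n, rhoD ρ p ⬝ᵥ η = 0 → 0 ≤ hess ρ p η) :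
    (∀ Z : Cn n → Cn n, IsSectionAt ρ Z p → Z p ≠ 0 →
      1 / 2 * (normSqD a ρ p)⁻¹ ≤ holSecCurv ρ Z p) ∧
    ∀ Z : Fin n → Cn n → Cn n, IsFrameAt ρ Z p →
      n ^ 2 * (normSqD a ρ p)⁻¹ ≤ scalarCurv ρ Z p := by
  have hstat : ∀ᶠ q in 𝓝 p, ρ q = 0 → HasStationaryHessianAt ρ q := by
    filter_upwards [hU.mem_nhds hp.1] with q hqU hq₀
    have hq : q ∈ zeroSet U ρ := ⟨hqU, hq₀⟩
    exact hasStationaryHessianAt_of_isLittleO (hρ.contDiffAt (hU.mem_nhds hqU)) hq₀ (hd q hq) ha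
      (hρa q hq)
  have hL : leviMat ρ p = a := leviMat_eq_of_isLittleO hp.2 (hρa p hp)
  rw [normSqD_eq_re_normalNormSq hL]
  exact ⟨fun Z hZ hZ₀ => half_inv_le_holSecCurv hstat hp.2 (hL ▸ ha) hconv hZ hZ₀,
    fun Z hZ => sq_mul_inv_le_scalarCurv hstat hp.2 (hL ▸ ha) hconv hZ⟩

namespace Pseudohermitian

open Complex Matrix

section Ellipsoid

variable {n : ℕ} (a b : Fin (n + 1) → ℝ)

theorem contDiff_ellipsoidFn : ContDiff ℝ ∞ (ellipsoidFn a b) := by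
  have hre (j) : ContDiff ℝ ∞ fun z : Cn n => (z j).re := reCLM.contDiff.comp (contDiff_apply ℝ ℂ j)
  have him (j) : ContDiff ℝ ∞ fun z : Cn n => (z j).im := imCLM.contDiff.comp (contDiff_apply ℝ ℂ j)
  exact (ContDiff.sum fun j _ => (contDiff_const.mul ((hre j).pow 2)).add
    (contDiff_const.mul ((him j).pow 2))).sub contDiff_const

theorem fderiv_ellipsoidFn_apply (z v : Cn n) :
    fderiv ℝ (ellipsoidFn a b) z v =
      ∑ j, (2 * a j * (z j).re * (v j).re + 2 * b j * (z j).im * (v j).im) := by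
  let x (j : Fin (n + 1)) : Cn n →L[ℝ] ℝ := reCLM.comp (.proj j)
  let y (j : Fin (n + 1)) : Cn n →L[ℝ] ℝ := imCLM.comp (.proj j)
  have h : fderiv ℝ (ellipsoidFn a b) z v = _ :=
    DFunLike.congr_fun (((HasFDerivAt.fun_sum fun j (_ : j ∈ Finset.univ) =>
      (((x j).hasFDerivAt.pow 2).const_mul (a j)).fun_add
        (((y j).hasFDerivAt.pow 2).const_mul (b j))).sub_const 1).fderiv) v
  rw [h, _root_.sum_apply]
  refine Finset.sum_congr rfl fun j _ => ?_
  simp only [x, y, ContinuousLinearMap.comp_apply, ContinuousLinearMap.proj_apply, reCLM_apply,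
    imCLM_apply, Nat.add_one_sub_one, pow_one, nsmul_eq_mul, Nat.cast_ofNat, _root_.add_apply,
    _root_.smul_apply, smul_eq_mul]
  ring

theorem fderiv_ellipsoidFn_self (z : Cn n) :
    fderiv ℝ (ellipsoidFn a b) z z = 2 * (ellipsoidFn a b z + 1) := by
  rw [fderiv_ellipsoidFn_apply, ellipsoidFn, sub_add_cancel, Finset.mul_sum]
  exact Finset.sum_congr rfl fun j _ => by ring

theorem rhoD_ellipsoidFn (z : Cn n) (j : Fin (n + 1)) :
    rhoD (ellipsoidFn a b) z j = (a j - b j) / 2 * z j + (a j + b j) / 2 * star (z j) := by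
  have hd := (contDiff_ellipsoidFn a b).differentiable (by simp) z
  have hsingle (c : ℂ) : fderiv ℝ (ellipsoidFn a b) z (Pi.single j c) =
      2 * a j * (z j).re * c.re + 2 * b j * (z j).im * c.im := by
    rw [fderiv_ellipsoidFn_apply, Finset.sum_eq_single j (fun k _ hk => by simp [hk]) (by simp),
      Pi.single_eq_same]
  rw [rhoD, dz, fderiv_ofReal_comp hd, fderiv_ofReal_comp hd, hsingle, hsingle]
  apply Complex.ext <;> simp <;> ring

theorem rhoDbar_ellipsoidFn (z : Cn n) (j : Fin (n + 1)) :
    rhoDbar (ellipsoidFn a b) z j = (a j + b j) / 2 * z j + (a j - b j) / 2 * star (z j) := by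
  rw [rhoDbar_eq_star_rhoD, Pi.star_apply, rhoD_ellipsoidFn]
  simp [add_comm]

theorem dz_mul_coord_add_mul_star_coord (c d : ℂ) (j k : Fin (n + 1)) (z : Cn n) :
    dz (fun z : Cn n => c * z k + d * star (z k)) j z = if j = k then c else 0 := by
  let x : Cn n →L[ℝ] ℂ := .proj k
  have h (v : Cn n) :
      fderiv ℝ (fun z : Cn n => c * z k + d * star (z k)) z v = c * v k + d * star (v k) :=
    DFunLike.congr_fun
      ((x.hasFDerivAt.const_mul c).fun_add (x.hasFDerivAt.star.const_mul d)).fderiv v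
  rw [dz, h, h]
  obtain rfl | hjk := eq_or_ne j k
  · simp only [Pi.single_eq_same, star_one, star_def, conj_I, if_true]
    linear_combination (d - c) / 2 * I_mul_I
  · simp [hjk, hjk.symm]

theorem leviMat_ellipsoidFn (z : Cn n) :
    leviMat (ellipsoidFn a b) z = diagonal fun j => (((a j + b j) / 2 : ℝ) : ℂ) := by
  ext j k
  simp only [leviMat, rhoDbar_ellipsoidFn, dz_mul_coord_add_mul_star_coord, diagonal_apply]
  split_ifs with hjk <;> simp [hjk]

theorem rhoDD_ellipsoidFn (z : Cn n) :
    rhoDD (ellipsoidFn a b) z = diagonal fun j => (((a j - b j) / 2 : ℝ) : ℂ) := by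
  ext j k
  simp only [rhoDD, rhoD_ellipsoidFn, dz_mul_coord_add_mul_star_coord, diagonal_apply]
  split_ifs with hjk <;> simp [hjk]

theorem hess_ellipsoidFn (z η : Cn n) :
    hess (ellipsoidFn a b) z η = ∑ j, (a j * (η j).re ^ 2 + b j * (η j).im ^ 2) := by
  simp only [hess, rhoDD_ellipsoidFn, leviMat_ellipsoidFn, diagonal_apply, ite_mul, zero_mul,
    Finset.sum_ite_eq, Finset.mem_univ, if_true, re_sum, ← Finset.sum_add_distrib]
  refine Finset.sum_congr rfl fun j _ => ?_
  simp only [ofReal_div, ofReal_sub, ofReal_add, ofReal_ofNat, mul_re, mul_im, div_ofNat_re,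
    div_ofNat_im, sub_re, sub_im, add_re, add_im, ofReal_re, ofReal_im, star_def, conj_re, conj_im]
  ring

variable {a b}

theorem fderiv_ellipsoidFn_ne_zero {z : Cn n} (hz : ellipsoidFn a b z = 0) :
    fderiv ℝ (ellipsoidFn a b) z ≠ 0 := by
  intro h
  simpa [h, hz] using fderiv_ellipsoidFn_self a b z

theorem posDef_leviMat_ellipsoidFn (ha : ∀ j, 0 < a j) (hb : ∀ j, 0 < b j) (z : Cn n) :
    (leviMat (ellipsoidFn a b) z).PosDef := by
  rw [leviMat_ellipsoidFn, posDef_diagonal_iff]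
  exact fun j => zero_lt_real.2 (half_pos (add_pos (ha j) (hb j)))

theorem isLittleO_leviMat_ellipsoidFn (p q : Cn n) (j k : Fin (n + 1)) :
    (fun z => leviMat (ellipsoidFn a b) z j k - leviMat (ellipsoidFn a b) p j k) =o[𝓝 q]
      ellipsoidFn a b := by
  simp only [leviMat_ellipsoidFn, sub_self]
  exact isLittleO_zero _ _

theorem hess_ellipsoidFn_nonneg (ha : ∀ j, 0 < a j) (hb : ∀ j, 0 < b j) (z η : Cn n) :
    0 ≤ hess (ellipsoidFn a b) z η := by
  rw [hess_ellipsoidFn]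
  exact Finset.sum_nonneg fun j _ =>
    add_nonneg (mul_nonneg (ha j).le (sq_nonneg _)) (mul_nonneg (hb j).le (sq_nonneg _))

theorem scalarCurv_ellipsoidFn_pos (hn : 1 ≤ n) (ha : ∀ j, 0 < a j) (hb : ∀ j, 0 < b j) {p : Cn n}
    (hp : ellipsoidFn a b p = 0) {Z : Fin n → Cn n → Cn n} (hZ : IsFrameAt (ellipsoidFn a b) Z p) :
    0 < scalarCurv (ellipsoidFn a b) Z p := by
  have hL := posDef_leviMat_ellipsoidFn ha hb p
  have hρ := contDiff_ellipsoidFn a b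
  have hpos : 0 < normSqD (leviMat (ellipsoidFn a b) p) (ellipsoidFn a b) p :=
    normSqD_pos rfl (hρ.differentiable (by simp) p) (fderiv_ellipsoidFn_ne_zero hp) hL
  have hle := (corollary1p3_general isOpen_univ hρ.contDiffOn
    (fun q hq => fderiv_ellipsoidFn_ne_zero hq.2) hL
    (fun q _ => isLittleO_leviMat_ellipsoidFn p q) ⟨Set.mem_univ p, hp⟩
    fun η _ => hess_ellipsoidFn_nonneg ha hb p η).2 Z hZ
  exact lt_of_lt_of_le (by positivity) hle

end Ellipsoid

end Pseudohermitian

theorem corollary1p3 :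
    (∀ (n : ℕ) (U : Set (Cn n)) (ρ : Cn n → ℝ) (a : Matrix (Fin (n + 1)) (Fin (n + 1)) ℂ),
      IsOpen U → ContDiffOn ℝ ∞ ρ U →
      (∀ p ∈ zeroSet U ρ, fderiv ℝ ρ p ≠ 0) →
      a.PosDef →
      (∀ p ∈ zeroSet U ρ, ∀ j k, (fun z => leviMat ρ z j k - a j k) =o[𝓝 p] ρ) →
      IsCConvex U ρ →
      ∀ p ∈ zeroSet U ρ, ∀ Z : Cn n → Cn n, IsSectionAt ρ Z p → Z p ≠ 0 →
        1 / 2 * (normSqD a ρ p)⁻¹ ≤ holSecCurv ρ Z p) ∧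
    (∀ (n : ℕ) (a b : Fin (n + 1) → ℝ), 1 ≤ n → (∀ j, 0 < a j) → (∀ j, 0 < b j) →
      ∀ p ∈ zeroSet Set.univ (ellipsoidFn a b), ∀ Z : Fin n → Cn n → Cn n,
        IsFrameAt (ellipsoidFn a b) Z p → 0 < scalarCurv (ellipsoidFn a b) Z p) :=
  ⟨fun _ _ _ _ hU hρ hd ha hρa hconv p hp =>
    (corollary1p3_general hU hρ hd ha hρa hp (hconv p hp)).1,
    fun _ _ _ hn ha hb _ hp _ hZ => scalarCurv_ellipsoidFn_pos hn ha hb hp.2 hZ⟩
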